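/- Let $G$ be a finitely generated group with word length $\ell$ associated with a finite symmetric generating set, let $H\le G$ be a subgroup, and let $X=G/H$ with base point $o=eH$ and projection $\pi:G\to X$. For $f:G\to\mathbb C$ put $\|f\|_{(2,1)}=\bigl(\sum_{x\in X}\bigl(\sum_{gH=x}|f(g)|\bigr)^2\bigr)^{1/2}$, and for $f\in\mathbb CG$ let $\|f\|_h=\sup\{\|f*\varphi\|_{(2,1)}:\varphi\in\mathbb CG,\ \|\varphi\|_{(2,1)}\le 1\}$. Assume that $(G,H)$ has pair rapid decay with constants $C_h,s_1>0$, that is, $\|f\|_h\le C_h\|f(1+\ell)^{s_1}\|_{(2,1)}$ for all $f\in\mathbb CG$. Let $\mu$ be a probability measure on $G$ with finite Shannon entropy and with $\sum_{g}\mu(g)(1+\ell(g))^{\beta}<\infty$ for some $\beta\ge 2s_1$. Let $\nu_n=\mu^{*n}*\delta_{o}=\pi_\#(\mu^{*n})$ be the law at time $n$ of the induced random walk on $X$. For a probability measure $\nu$ on $X$ and $\alpha>1$ let $H(\nu)=-\sum_x\nu(x)\log\nu(x)$ and $H_\alpha(\nu)=\frac1{1-\alpha}\log\sum_x\nu(x)^\alpha$.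 Let $\underline h(X,\mu)$, $\overline h(X,\mu)$ be the $\liminf$ and $\limsup$ of $\frac1nH(\nu_n)$, and let $\underline h_\alpha(X,\mu)$, $\overline h_\alpha(X,\mu)$ be the $\liminf$ and $\limsup$ of $\frac1nH_\alpha(\nu_n)$, as $n\to\infty$. For $q\in(1,2]$ let $r_q(\mu)$ be the spectral radius of the Markov operator $\xi\mapsto\sum_g\mu(g)\,\xi(g^{-1}\,\cdot\,)$ on the complex Banach space $\ell^q(X)$, and let $c(G,H;\mu)=\lim_{p\to\infty}\bigl(-p\log r_{p/(p-1)}(\mu)\bigr)$. Then the limit defining $c(G,H;\mu)$ exists and is finite, and $$\underline h(X,\mu)=\overline h(X,\mu)=c(G,H;\mu).$$ Hence the asymptotic Shannon entropy $h(X,\mu)=\lim_{n\to\infty}\frac1nH(\nu_n)$ exists, is finite and equals $c(G,H;\mu)$. Moreover, $$\lim_{\alpha\downarrow1}\underline h_\alpha(X,\mu)=\lim_{\alpha\downarrow1}\overline h_\alpha(X,\mu)=h(X,\mu).$$ If $\mu$ is finitely supported, then for every $\alpha\in(1,2]$ the limit $h_\alpha(X,\mu)=\lim_{n\to\infty}\frac1nH_\alpha(\nu_n)$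 exists, is finite and satisfies $h_\alpha(X,\mu)=\frac{\alpha}{1-\alpha}\log r_\alpha(\mu)$; in particular $\lim_{\alpha\downarrow1}h_\alpha(X,\mu)=h(X,\mu)$. -/

import Mathlib

open Filter Topology
open scoped ENNReal NNReal

noncomputable section

namespace HomogeneousEntropy

/-- `ℓ_S(g)`: the least `n` such that `g` is a product of `n` elements of `S`. -/
def wordLength {G : Type*} [Group G] (S : Finset G) (g : G) : ℕ :=
  sInf {n | ∃ l : List G, (∀ s ∈ l, s ∈ S) ∧ l.prod = g ∧ l.length = n}

/-- Fiber summation along `π : G → G/H`: `(π_# u)(x) = ∑_{gH = x} u(g)`. -/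
def fiberSum {G : Type*} [Group G] (H : Subgroup G) (u : G → ℝ≥0∞) (x : G ⧸ H) : ℝ≥0∞ :=
  ∑' g : {g : G // (g : G ⧸ H) = x}, u g

/-- The mixed norm `‖f‖_{(2,1)} = ‖π_# |f|‖_{ℓ²(G/H)}`. -/
def mixedNorm {G : Type*} [Group G] (H : Subgroup G) (f : G → ℂ) : ℝ≥0∞ :=
  (∑' x : G ⧸ H, fiberSum H (fun g => ‖f g‖ₑ) x ^ 2) ^ (1 / 2 : ℝ)

/-- `‖f‖_h`: the norm of `φ ↦ f * φ` (convolution on `ℂG`) with respect to `‖·‖_{(2,1)}`. -/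
def hybridNorm {G : Type*} [Group G] (H : Subgroup G) (f : MonoidAlgebra ℂ G) : ℝ≥0∞ :=
  ⨆ (φ : MonoidAlgebra ℂ G) (_ : mixedNorm H φ.coeff ≤ 1), mixedNorm H (f * φ).coeff

/-- Pair rapid decay of `(G, H)` with constants `C > 0` and `s₁ > 0`:
`‖f‖_h ≤ C ‖f (1 + ℓ)^{s₁}‖_{(2,1)}` for every `f ∈ ℂG`. -/
def PairRapidDecay {G : Type*} [Group G] (S : Finset G) (H : Subgroup G) (C s₁ : ℝ) : Prop :=
  0 < C ∧ 0 < s₁ ∧ ∀ f : MonoidAlgebra ℂ G,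
    hybridNorm H f ≤ ENNReal.ofReal C *
      mixedNorm H (fun g => f.coeff g * (((1 + (wordLength S g : ℝ)) ^ s₁ : ℝ) : ℂ))

/-- `∑_g μ(g) (1 + ℓ(g))^β < ∞`. -/
def HasFiniteMoment {G : Type*} [Group G] (S : Finset G) (μ : PMF G) (β : ℝ) : Prop :=
  ∑' g : G, μ g * ENNReal.ofReal ((1 + (wordLength S g : ℝ)) ^ β) < ∞

/-- The convolution power `μ^{*n}`, the law of `s_n ⋯ s_1` with `s_i` i.i.d. of law `μ`. -/
def convPow {G : Type*} [Group G] (μ : PMF G) : ℕ → PMF G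
  | 0 => PMF.pure 1
  | n + 1 => μ.bind fun s => (convPow μ n).map fun z => s * z

/-- `ν_n = μ^{*n} * δ_{eH} = π_#(μ^{*n})`, the law of the random walk on `G/H` at time `n`. -/
def walkLaw {G : Type*} [Group G] (H : Subgroup G) (μ : PMF G) (n : ℕ) : PMF (G ⧸ H) :=
  (convPow μ n).map fun g => (g : G ⧸ H)

/-- Shannon entropy `-∑ ν(x) log ν(x) ∈ [0, ∞]`. -/
def shannonEntropy {X : Type*} (ν : PMF X) : ℝ≥0∞ :=
  ∑' x, ENNReal.ofReal (Real.negMulLog (ν x).toReal)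

/-- Rényi entropy `(1 - α)⁻¹ log ∑ ν(x)^α` of order `α > 1`. -/
def renyiEntropy {X : Type*} (α : ℝ) (ν : PMF X) : EReal :=
  ((1 / (1 - α) : ℝ) : EReal) * ENNReal.log (∑' x, ν x ^ α)

/-- `H(ν_n) / n` -/
def shannonSeq {G : Type*} [Group G] (H : Subgroup G) (μ : PMF G) (n : ℕ) : EReal :=
  (shannonEntropy (walkLaw H μ n) : EReal) / (n : EReal)

/-- `H_α(ν_n) / n` -/
def renyiSeq {G : Type*} [Group G] (H : Subgroup G) (μ : PMF G) (α : ℝ) (n : ℕ) : EReal :=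
  renyiEntropy α (walkLaw H μ n) / (n : EReal)

/-- Lower asymptotic entropy. -/
def lowerEntropy {G : Type*} [Group G] (H : Subgroup G) (μ : PMF G) : EReal :=
  liminf (shannonSeq H μ) atTop

/-- Upper asymptotic entropy. -/
def upperEntropy {G : Type*} [Group G] (H : Subgroup G) (μ : PMF G) : EReal :=
  limsup (shannonSeq H μ) atTop

/-- Lower Rényi entropy rate. -/
def lowerRenyiRate {G : Type*} [Group G] (H : Subgroup G) (μ : PMF G) (α : ℝ) : EReal :=
  liminf (renyiSeq H μ α) atTop

/-- Upper Rényi entropy rate. -/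
def upperRenyiRate {G : Type*} [Group G] (H : Subgroup G) (μ : PMF G) (α : ℝ) : EReal :=
  limsup (renyiSeq H μ α) atTop

/-- The complex Banach space `ℓ^q(X)`. -/
abbrev ellq (X : Type*) (q : ℝ≥0∞) : Type _ := lp (fun _ : X => ℂ) q

theorem memlp_comp_equiv {X : Type*} {q : ℝ≥0∞} (e : X ≃ X) {ξ : X → ℂ}
    (hξ : Memℓp (E := fun _ : X => ℂ) ξ q) : Memℓp (E := fun _ : X => ℂ) (fun x => ξ (e x)) q := by
  rcases q.trichotomy with (rfl | rfl | hq)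
  · rw [memℓp_zero_iff] at hξ ⊢
    exact hξ.preimage e.injective.injOn
  · rw [memℓp_infty_iff] at hξ ⊢
    refine hξ.mono ?_
    rintro _ ⟨x, rfl⟩
    exact ⟨e x, rfl⟩
  · rw [memℓp_gen_iff hq] at hξ ⊢
    exact (e.summable_iff (f := fun x => ‖ξ x‖ ^ q.toReal)).2 hξ

theorem norm_comp_equiv {X : Type*} {q : ℝ≥0∞} [Fact (1 ≤ q)] (e : X ≃ X) (ξ : ellq X q) :
    ‖(⟨fun x => ξ (e x), memlp_comp_equiv e ξ.2⟩ : ellq X q)‖ = ‖ξ‖ := by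
  rcases q.trichotomy with (h | h | hq)
  · exact absurd (Fact.out : (1 : ℝ≥0∞) ≤ q) (by simp [h])
  · subst h
    rw [lp.norm_eq_ciSup, lp.norm_eq_ciSup]
    exact e.surjective.iSup_comp (g := fun x => ‖ξ x‖)
  · rw [lp.norm_eq_tsum_rpow hq, lp.norm_eq_tsum_rpow hq]
    congr 1
    exact e.tsum_eq (fun x => ‖ξ x‖ ^ q.toReal)

/-- The quasi-regular representation on `ℓ^q(G/H)`: `(λ(g) ξ)(x) = ξ(g⁻¹ x)`. -/
def quasiRegular {G : Type*} [Group G] (H : Subgroup G) (q : ℝ≥0∞) [Fact (1 ≤ q)] (g : G) :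
    ellq (G ⧸ H) q →L[ℂ] ellq (G ⧸ H) q :=
  LinearMap.mkContinuous
    { toFun := fun ξ => ⟨fun x => ξ (g⁻¹ • x), memlp_comp_equiv (MulAction.toPerm g⁻¹) ξ.2⟩
      map_add' := fun _ _ => rfl
      map_smul' := fun _ _ => rfl }
    1 (fun ξ => by
      rw [one_mul]
      exact (norm_comp_equiv (MulAction.toPerm g⁻¹) ξ).le)

/-- The Markov operator `λ_{X,q}(μ) = ∑_g μ(g) λ_{X,q}(g)` on `ℓ^q(G/H)`; the series converges
absolutely in operator norm, since each `λ_{X,q}(g)` is an isometry. -/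
def markovOp {G : Type*} [Group G] (H : Subgroup G) (q : ℝ≥0∞) [Fact (1 ≤ q)] (μ : PMF G) :
    ellq (G ⧸ H) q →L[ℂ] ellq (G ⧸ H) q :=
  ∑' g : G, ((μ g).toReal : ℂ) • quasiRegular H q g

open Classical in
/-- `r_q(μ)`, the spectral radius of the Markov operator on `ℓ^q(G/H)`, for real `q ≥ 1`
(the value for `q < 1` is immaterial). -/
def specRad {G : Type*} [Group G] (H : Subgroup G) (μ : PMF G) (q : ℝ) : ℝ≥0∞ :=
  if h : 1 ≤ ENNReal.ofReal q then
    haveI : Fact (1 ≤ ENNReal.ofReal q) := ⟨h⟩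
    spectralRadius ℂ (markovOp H (ENNReal.ofReal q) μ)
  else 0

/-- `-p log r_{p/(p-1)}(μ)` -/
def spectralFun {G : Type*} [Group G] (H : Subgroup G) (μ : PMF G) (p : ℝ) : EReal :=
  ((-p : ℝ) : EReal) * ENNReal.log (specRad H μ (p / (p - 1)))

/-- `c(G,H;μ) = lim_{p → ∞} (-p log r_{p/(p-1)}(μ))`. -/
def spectralEntropy {G : Type*} [Group G] (H : Subgroup G) (μ : PMF G) : EReal :=
  limUnder atTop (spectralFun H μ)

end HomogeneousEntropy

end

noncomputable section

namespace HomogeneousEntropy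

/-! Let P be the Markov operator, p > 1 and q = p/(p-1). Entropy and spectral radius are compared
from two sides, each with one variable fixed and the other tending to infinity.

With p fixed: evaluating P^n on the point mass at o gives ∑ ν_n^q ≤ ‖P^n‖_q^q, and Shannon entropy
dominates Rényi entropy, so H(ν_n) ≥ H_q(ν_n) ≥ -p log ‖P^n‖_q. Dividing by n and letting n → ∞
yields liminf H(ν_n)/n ≥ -p log r_q (`tsum_walkLaw_rpow_le`, `renyi_le_shannon`).

With n fixed: pair rapid decay bounds convolution operators on ℓ²(X). Interpolation with the trivial
ℓ¹ bound (`PairRapidDecay.tsum_act_rpow_le`) and Hölder on fibers give ‖P^n‖_q^q ≤ C^{2(q-1)}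
E[Y^{q-1}], where Y = ν_n(gH)(1+ℓ(g))^{2s₁} and g has law μ^{*n}. As q ↓ 1, E[Y^{q-1}] = 1 + (q-1)(E
log Y + o(1)), and E log Y = -H(ν_n) + 2s₁ E log(1+ℓ). Since r_q ≤ ‖P^n‖_q^{1/n}, for large p the
number -p log r_q is at least (H(ν_n) - 2 log C - 2s₁ E log(1+ℓ))/n up to a small error
(`PairRapidDecay.eventually_le_spectral`). Jensen makes E log(1+ℓ) of order at most log n, so the
correction vanishes as n → ∞.

Together the two inequalities force both quantities to the limit sup_{p ≥ 2} (-p log r_q)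
(`exists_common_limit`). The Rényi rates of order α lie between -p log r_α, with p = α/(α-1), and h.
For finite support the weight (1+ℓ)^{s₁} is at most polynomial in n on the support of μ^{*n}, which
identifies each Rényi rate exactly. -/

/-! ### Nonnegative kernels on `G/H` -/

/-- The action of a nonnegative function on `G` on nonnegative functions on `G/H`:
`x ↦ ∑_g m(g) ξ(g⁻¹ x)`. -/
def act {G : Type*} [Group G] (H : Subgroup G) (m : G → ℝ≥0∞) (ξ : G ⧸ H → ℝ≥0∞)
    (x : G ⧸ H) : ℝ≥0∞ :=
  ∑' g, m g * ξ (g⁻¹ • x)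

/-- `act H m ξ` is the image of the product of m and ξ under (g, x) ↦ g • x, so testing it against φ
is a change of variables. -/
theorem tsum_act_mul {G : Type*} [Group G] (H : Subgroup G) (m : G → ℝ≥0∞)
    (ξ φ : G ⧸ H → ℝ≥0∞) :
    ∑' x, act H m ξ x * φ x = ∑' g, ∑' x, m g * ξ x * φ (g • x) := by
  simp only [act, ← ENNReal.tsum_mul_right]
  rw [ENNReal.tsum_comm]
  refine tsum_congr fun g => ?_
  rw [← (MulAction.toPerm g : Equiv.Perm (G ⧸ H)).tsum_eq]
  simp

theorem tsum_act {G : Type*} [Group G] (H : Subgroup G) (m : G → ℝ≥0∞) (ξ : G ⧸ H → ℝ≥0∞) :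
    ∑' x, act H m ξ x = (∑' g, m g) * ∑' x, ξ x := by
  have := tsum_act_mul H m ξ 1
  simpa [ENNReal.tsum_mul_left, ENNReal.tsum_mul_right] using this

open Classical in
theorem fiberSum_eq_tsum_ite {G : Type*} [Group G] (H : Subgroup G) (u : G → ℝ≥0∞) (x : G ⧸ H) :
    fiberSum H u x = ∑' g : G, if (g : G ⧸ H) = x then u g else 0 := by
  refine (tsum_subtype {g : G | (g : G ⧸ H) = x} u).trans ?_
  exact tsum_congr fun g => by simp [Set.indicator_apply]

theorem tsum_fiberSum_mul {G : Type*} [Group G] (H : Subgroup G) (u : G → ℝ≥0∞)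
    (φ : G ⧸ H → ℝ≥0∞) :
    ∑' x, fiberSum H u x * φ x = ∑' g : G, u g * φ g := by
  classical
  simp only [fiberSum_eq_tsum_ite, ← ENNReal.tsum_mul_right]
  rw [ENNReal.tsum_comm]
  refine tsum_congr fun g => ?_
  rw [tsum_eq_single (g : G ⧸ H)]
  · simp
  · intro x hx
    simp [hx.symm]

theorem fiberSum_mono {G : Type*} [Group G] (H : Subgroup G) {u v : G → ℝ≥0∞}
    (h : ∀ g, u g ≤ v g) (x : G ⧸ H) : fiberSum H u x ≤ fiberSum H v x :=
  ENNReal.tsum_le_tsum fun g => h g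

theorem le_fiberSum {G : Type*} [Group G] (H : Subgroup G) (u : G → ℝ≥0∞) (g : G) :
    u g ≤ fiberSum H u (g : G ⧸ H) :=
  ENNReal.le_tsum (f := fun k : {k : G // (k : G ⧸ H) = (g : G ⧸ H)} => u k) ⟨g, rfl⟩

/-- Fiber summation intertwines convolution on `G` with the action on `G/H`. -/
theorem fiberSum_conv {G : Type*} [Group G] (H : Subgroup G) (f φ : G → ℝ≥0∞) (x : G ⧸ H) :
    fiberSum H (fun g => ∑' a, f a * φ (a⁻¹ * g)) x = act H f (fiberSum H φ) x := by
  classical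
  simp only [fiberSum_eq_tsum_ite, act]
  have : ∀ g : G, (if (g : G ⧸ H) = x then ∑' a, f a * φ (a⁻¹ * g) else 0) =
      ∑' a, if (g : G ⧸ H) = x then f a * φ (a⁻¹ * g) else 0 := fun g => by
    split_ifs <;> simp
  simp only [this]
  rw [ENNReal.tsum_comm]
  refine tsum_congr fun a => ?_
  rw [← ENNReal.tsum_mul_left, ← (Equiv.mulLeft a).tsum_eq]
  refine tsum_congr fun g => ?_
  have h : ((a * g : G) : G ⧸ H) = x ↔ (g : G ⧸ H) = a⁻¹ • x := by
    rw [eq_inv_smul_iff]; rfl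
  simp [h]

/-! ### Pair rapid decay for nonnegative functions -/

/-- The weight `(1 + ℓ)^s` with values in `ℝ≥0∞`. -/
def lengthWeight {G : Type*} [Group G] (S : Finset G) (s : ℝ) (g : G) : ℝ≥0∞ :=
  ENNReal.ofReal ((1 + (wordLength S g : ℝ)) ^ s)

theorem lengthWeight_ne_zero {G : Type*} [Group G] (S : Finset G) (s : ℝ) (g : G) :
    lengthWeight S s g ≠ 0 := by
  rw [lengthWeight, Ne, ENNReal.ofReal_eq_zero, not_le]
  positivity

theorem lengthWeight_ne_top {G : Type*} [Group G] (S : Finset G) (s : ℝ) (g : G) :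
    lengthWeight S s g ≠ ∞ := ENNReal.ofReal_ne_top

/-- A finitely supported nonnegative function, as an element of the group algebra. -/
def toGroupAlgebra {G : Type*} (f : G →₀ ℝ≥0) : MonoidAlgebra ℂ G :=
  MonoidAlgebra.ofCoeff (f.mapRange (fun r : ℝ≥0 => ((r : ℝ) : ℂ)) (by simp))

theorem coeff_toGroupAlgebra {G : Type*} (f : G →₀ ℝ≥0) (g : G) :
    (toGroupAlgebra f).coeff g = ((f g : ℝ) : ℂ) := rfl

theorem enorm_coeff_toGroupAlgebra {G : Type*} (f : G →₀ ℝ≥0) (g : G) :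
    ‖(toGroupAlgebra f).coeff g‖ₑ = f g := by
  rw [coeff_toGroupAlgebra, ← ofReal_norm, Complex.norm_real,
    Real.norm_of_nonneg (NNReal.coe_nonneg _), ENNReal.ofReal_coe_nnreal]

/-- For nonnegative coefficients no cancellation occurs, so absolute values commute with
convolution. -/
theorem enorm_coeff_toGroupAlgebra_mul {G : Type*} [Group G] (f φ : G →₀ ℝ≥0) (g : G) :
    ‖(toGroupAlgebra f * toGroupAlgebra φ).coeff g‖ₑ = ∑' a, (f a : ℝ≥0∞) * φ (a⁻¹ * g) := by
  have h : (toGroupAlgebra f * toGroupAlgebra φ).coeff g =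
      (((∑ a ∈ f.support, f a * φ (a⁻¹ * g) : ℝ≥0) : ℝ) : ℂ) := by
    rw [MonoidAlgebra.coeff_mul_apply_left]
    rw [Finsupp.sum_of_support_subset (s := f.support) _ (fun a ha => ?_) _ (by simp)]
    · simp [coeff_toGroupAlgebra]
    · rw [Finsupp.mem_support_iff, coeff_toGroupAlgebra] at ha
      rw [Finsupp.mem_support_iff]
      exact fun h => ha (by simp [h])
  rw [h, tsum_eq_sum (s := f.support)]
  · rw [← ofReal_norm, Complex.norm_real, Real.norm_of_nonneg (NNReal.coe_nonneg _),
      ENNReal.ofReal_coe_nnreal]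
    simp
  · intro a ha
    simp [Finsupp.notMem_support_iff.1 ha]

theorem mixedNorm_smul {G : Type*} [Group G] (H : Subgroup G) (c : ℂ) (f : G → ℂ) :
    mixedNorm H (c • f) = ‖c‖ₑ * mixedNorm H f := by
  have h : ∀ x : G ⧸ H, fiberSum H (fun g => ‖(c • f) g‖ₑ) x =
      ‖c‖ₑ * fiberSum H (fun g => ‖f g‖ₑ) x := fun x => by
    simp only [fiberSum, Pi.smul_apply, smul_eq_mul, enorm_mul, ENNReal.tsum_mul_left]
  simp only [mixedNorm, h, mul_pow, ENNReal.tsum_mul_left]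
  rw [ENNReal.mul_rpow_of_nonneg _ _ (by norm_num), ← ENNReal.rpow_natCast, ← ENNReal.rpow_mul]
  norm_num

theorem tsum_sq_le_sq_tsum {X : Type*} (u : X → ℝ≥0∞) : ∑' x, u x ^ 2 ≤ (∑' x, u x) ^ 2 := by
  rw [sq (∑' x, u x), ← ENNReal.tsum_mul_right]
  exact ENNReal.tsum_le_tsum fun x => by
    rw [sq]
    gcongr
    exact ENNReal.le_tsum x

/-- The supremum in `hybridNorm` runs over the unit ball, so φ has to be normalised: its norm is
finite by finite support, and it vanishes only for φ = 0. -/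
theorem mixedNorm_mul_le {G : Type*} [Group G] (H : Subgroup G) (f φ : G →₀ ℝ≥0) :
    mixedNorm H (toGroupAlgebra f * toGroupAlgebra φ).coeff ≤
      hybridNorm H (toGroupAlgebra f) * mixedNorm H (toGroupAlgebra φ).coeff := by
  have hbound : mixedNorm H (toGroupAlgebra φ).coeff ≠ ∞ := by
    refine (ENNReal.rpow_lt_top_of_nonneg (by norm_num) ?_).ne
    refine ((tsum_sq_le_sq_tsum _).trans_lt (ENNReal.pow_lt_top ?_)).ne
    have := tsum_fiberSum_mul H (fun g => ‖(toGroupAlgebra φ).coeff g‖ₑ) 1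
    simp only [Pi.one_apply, mul_one] at this
    rw [this]
    simp only [enorm_coeff_toGroupAlgebra]
    rw [tsum_eq_sum (s := φ.support) (fun a ha => by simp [Finsupp.notMem_support_iff.1 ha])]
    exact ENNReal.sum_lt_top.2 fun a _ => ENNReal.coe_lt_top
  rcases eq_or_ne (mixedNorm H (toGroupAlgebra φ).coeff) 0 with h0 | h0
  · have hφ : φ = 0 := by
      ext g
      simp only [mixedNorm, one_div, ENNReal.rpow_eq_zero_iff, ENNReal.tsum_eq_zero] at h0
      rcases h0 with ⟨h0, -⟩ | ⟨-, h0⟩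
      · have h1 := (pow_eq_zero_iff two_ne_zero).1 (h0 (g : G ⧸ H))
        have h2 := le_fiberSum H (fun g => ‖(toGroupAlgebra φ).coeff g‖ₑ) g
        rw [h1] at h2
        simpa [enorm_coeff_toGroupAlgebra] using h2
      · norm_num at h0
    have : toGroupAlgebra φ = 0 := by
      ext g
      simp [coeff_toGroupAlgebra, hφ]
    rw [this, mul_zero]
    simp [mixedNorm, fiberSum]
  · set t := mixedNorm H (toGroupAlgebra φ).coeff with ht
    set c : ℂ := ((t.toReal⁻¹ : ℝ) : ℂ) with hc
    have hcn : ‖c‖ₑ = t⁻¹ := by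
      rw [hc, ← ofReal_norm, Complex.norm_real, Real.norm_of_nonneg (by positivity),
        ENNReal.ofReal_inv_of_pos (ENNReal.toReal_pos h0 hbound), ENNReal.ofReal_toReal hbound]
    have h1 : mixedNorm H (c • toGroupAlgebra φ).coeff ≤ 1 := by
      rw [MonoidAlgebra.coeff_smul, Finsupp.coe_smul, mixedNorm_smul, hcn, ← ht,
        ENNReal.inv_mul_cancel h0 hbound]
    have h2 : mixedNorm H (toGroupAlgebra f * c • toGroupAlgebra φ).coeff ≤
        hybridNorm H (toGroupAlgebra f) :=
      le_iSup₂_of_le (f := fun (ψ : MonoidAlgebra ℂ G) (_ : mixedNorm H ψ.coeff ≤ 1) =>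
        mixedNorm H (toGroupAlgebra f * ψ).coeff) (c • toGroupAlgebra φ) h1 le_rfl
    rw [mul_smul_comm, MonoidAlgebra.coeff_smul, Finsupp.coe_smul, mixedNorm_smul, hcn,
      mul_comm, ← div_eq_mul_inv] at h2
    exact (ENNReal.div_le_iff h0 hbound).1 h2

/-- This turns pair rapid decay, a statement on G, into an ℓ² operator bound on G/H: any ξ is the
fiber sum of some φ, and fiber summation carries f * φ to the action of f on ξ. -/
theorem PairRapidDecay.tsum_act_sq_le {G : Type*} [Group G] {S : Finset G} {H : Subgroup G}
    {C s₁ : ℝ} (hRD : PairRapidDecay S H C s₁) (f : G → ℝ≥0∞) (hf : ∀ g, f g ≠ ∞)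
    (hfs : f.support.Finite) (ξ : G ⧸ H → ℝ≥0∞) (hξ : ∀ x, ξ x ≠ ∞) (hξs : ξ.support.Finite) :
    ∑' x, act H f ξ x ^ 2 ≤ ENNReal.ofReal C ^ 2 *
      (∑' x, fiberSum H (fun g => f g * lengthWeight S s₁ g) x ^ 2) * ∑' x, ξ x ^ 2 := by
  classical
  set f' : G →₀ ℝ≥0 := Finsupp.ofSupportFinite (fun g => (f g).toNNReal)
    (hfs.subset fun g hg h => hg (by simp [h])) with hf'
  have hf'c : ∀ g, (f' g : ℝ≥0∞) = f g := fun g => ENNReal.coe_toNNReal (hf g)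
  -- The lift puts the whole mass ξ(x) on one chosen representative of the coset x.
  set φ₀ : G → ℝ≥0 := fun g => if g = (g : G ⧸ H).out then (ξ g).toNNReal else 0 with hφ₀
  have hφs : φ₀.support.Finite := by
    refine (hξs.image Quotient.out).subset fun g hg => ?_
    by_cases h : g = (g : G ⧸ H).out
    · refine ⟨(g : G ⧸ H), fun h0 => hg ?_, h.symm⟩
      simp [hφ₀, h0]
    · exact absurd (by simp [hφ₀, h]) hg
  set φ : G →₀ ℝ≥0 := Finsupp.ofSupportFinite φ₀ hφs with hφ
  have hφξ : ∀ x, fiberSum H (fun g => (φ g : ℝ≥0∞)) x = ξ x := by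
    intro x
    have hx : ((x.out : G) : G ⧸ H) = x := Quotient.out_eq' x
    rw [fiberSum_eq_tsum_ite, tsum_eq_single x.out]
    · change (if ((x.out : G) : G ⧸ H) = x then ((φ₀ x.out : ℝ≥0) : ℝ≥0∞) else 0) = ξ x
      simp [hφ₀, hx, ENNReal.coe_toNNReal (hξ x)]
    · intro g hg
      split_ifs with h
      · have : φ g = φ₀ g := rfl
        rw [this]
        subst h
        simp [hφ₀, hg]
      · rfl
  have key := (mixedNorm_mul_le H f' φ).trans
    (mul_le_mul_left (hRD.2.2 (toGroupAlgebra f')) _)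
  have hw : ∀ g, ‖(toGroupAlgebra f').coeff g * (((1 + (wordLength S g : ℝ)) ^ s₁ : ℝ) : ℂ)‖ₑ =
      f g * lengthWeight S s₁ g := fun g => by
    rw [enorm_mul, enorm_coeff_toGroupAlgebra, hf'c, lengthWeight, ← ofReal_norm,
      Complex.norm_real, Real.norm_of_nonneg (by positivity)]
  simp only [mixedNorm, hw, enorm_coeff_toGroupAlgebra, enorm_coeff_toGroupAlgebra_mul,
    hφξ, hf'c] at key
  simp only [fiberSum_conv H f (fun g => (φ g : ℝ≥0∞)), funext hφξ] at key
  have key2 := ENNReal.rpow_le_rpow key (zero_le_two (α := ℝ))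
  rw [ENNReal.mul_rpow_of_nonneg _ _ zero_le_two, ENNReal.mul_rpow_of_nonneg _ _ zero_le_two,
    ← ENNReal.rpow_mul, ← ENNReal.rpow_mul, ← ENNReal.rpow_mul] at key2
  norm_num at key2
  exact key2

/-! ### Interpolation between `ℓ¹` and `ℓ²` for nonnegative kernels -/

theorem tsum_rpow_mul_rpow_le {X : Type*} (u v : X → ℝ≥0∞) {a b : ℝ} (ha : 0 ≤ a) (hb : 0 ≤ b)
    (hab : a + b = 1) :
    ∑' x, u x ^ a * v x ^ b ≤ (∑' x, u x) ^ a * (∑' x, v x) ^ b := by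
  let _ : MeasurableSpace X := ⊤
  have h := ENNReal.lintegral_mul_norm_pow_le (μ := MeasureTheory.Measure.count)
    (f := u) (g := v) measurable_from_top.aemeasurable measurable_from_top.aemeasurable ha hb hab
  simpa only [MeasureTheory.lintegral_count] using h

theorem fiberSum_mul_coe {G : Type*} [Group G] (H : Subgroup G) (u : G → ℝ≥0∞)
    (φ : G ⧸ H → ℝ≥0∞) (x : G ⧸ H) :
    fiberSum H (fun g => u g * φ g) x = fiberSum H u x * φ x := by
  rw [fiberSum, fiberSum, ← ENNReal.tsum_mul_right]
  exact tsum_congr fun g => by rw [g.2]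

/-- A hands-on form of complex interpolation, available because everything is nonnegative: f and ξ
factor into an ℓ¹ part and an ℓ² part, and Hölder is applied once in g and once in x. The parameter
θ solves 1/q = (1-θ)/1 + θ/2. -/
theorem PairRapidDecay.tsum_act_rpow_le_of_finite {G : Type*} [Group G] {S : Finset G}
    {H : Subgroup G} {C s₁ : ℝ} (hRD : PairRapidDecay S H C s₁) {q : ℝ} (hq : 1 < q) (hq2 : q ≤ 2)
    (f : G → ℝ≥0∞) (hf : ∀ g, f g ≠ ∞) (hfs : f.support.Finite)
    (ξ : G ⧸ H → ℝ≥0∞) (hξ : ∀ x, ξ x ≠ ∞) (hξs : ξ.support.Finite) :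
    ∑' x, act H f ξ x ^ q ≤ ENNReal.ofReal C ^ (2 * (q - 1)) *
      (∑' x, fiberSum H (fun g => f g * lengthWeight S s₁ g ^ (2 * (q - 1) / q)) x ^ q) *
        ∑' x, ξ x ^ q := by
  set W := lengthWeight S s₁ with hW
  set θ : ℝ := 2 * (q - 1) / q with hθ
  have hq0 : 0 < q := by linarith
  have hθq : θ * q = 2 * (q - 1) := by rw [hθ]; field_simp
  have hθ0 : 0 < θ := by rw [hθ]; exact div_pos (by linarith) hq0
  have hθ1 : (1 - θ) * q = 2 - q := by rw [sub_mul, hθq]; ring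
  have hθ1' : 0 ≤ 1 - θ := by
    by_contra h
    nlinarith [mul_neg_of_neg_of_pos (not_le.1 h) hq0]
  set F : G ⧸ H → ℝ≥0∞ := fiberSum H (fun g => f g * W g ^ θ) with hF
  have hW0 : ∀ g, W g ≠ 0 := lengthWeight_ne_zero S s₁
  have hWt : ∀ g, W g ≠ ∞ := lengthWeight_ne_top S s₁
  have hWr0 : ∀ g (t : ℝ), W g ^ t ≠ 0 := fun g t => by
    simp [ENNReal.rpow_eq_zero_iff, hW0, hWt]
  have hWrt : ∀ g (t : ℝ), W g ^ t ≠ ∞ := fun g t => by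
    simp [ENNReal.rpow_eq_top_iff, hW0, hWt]
  have hFt : ∀ x, F x ≠ ∞ := by
    intro x
    have h1 : F x ≤ ∑' g, f g * W g ^ θ :=
      ENNReal.tsum_comp_le_tsum_of_injective Subtype.val_injective _
    refine (h1.trans_lt ?_).ne
    rw [tsum_eq_sum (s := hfs.toFinset) (fun g hg => ?_)]
    · exact ENNReal.sum_lt_top.2 fun g _ => ENNReal.mul_lt_top (hf g).lt_top (hWrt g θ).lt_top
    · simp only [Set.Finite.mem_toFinset, Function.mem_support, not_not] at hg
      simp [hg]
  have hF0 : ∀ g, f g ≠ 0 → F g ≠ 0 := fun g hg h0 => by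
    have := le_fiberSum H (fun g => f g * W g ^ θ) g
    rw [← hF, h0, nonpos_iff_eq_zero, mul_eq_zero] at this
    exact this.elim hg (hWr0 g θ)
  -- The powers of W and F are chosen to cancel in f₀^(1-θ) f₁^θ = f, while the mass of f₀ and the
  -- squared weighted (2,1)-norm of f₁ both equal ∑ F^q.
  set f₀ : G → ℝ≥0∞ := fun g => f g * W g ^ θ * F g ^ (q - 1) with hf₀
  set f₁ : G → ℝ≥0∞ := fun g => f g * W g ^ (θ - 1) * F g ^ (q / 2 - 1) with hf₁
  have hsum₀ : ∑' g, f₀ g = ∑' x, F x ^ q := by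
    rw [hf₀, ← tsum_fiberSum_mul H (fun g => f g * W g ^ θ) (fun x => F x ^ (q - 1))]
    refine tsum_congr fun x => ?_
    rw [← hF]
    conv_lhs => rw [← ENNReal.rpow_one (F x), ← ENNReal.rpow_mul, one_mul]
    rw [← ENNReal.rpow_add_of_nonneg _ _ zero_le_one (by linarith)]
    congr 1
    ring
  have hsum₁ : ∀ x, fiberSum H (fun g => f₁ g * W g) x ^ 2 = F x ^ q := by
    intro x
    have h1 : (fun g => f₁ g * W g) = fun g : G => f g * W g ^ θ * F g ^ (q / 2 - 1) := by
      funext g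
      have : W g ^ θ = W g ^ (θ - 1) * W g := by
        conv_rhs => rw [← ENNReal.rpow_one (W g), ← ENNReal.rpow_mul, one_mul,
          ← ENNReal.rpow_add _ _ (hW0 g) (hWt g)]
        congr 1
        ring
      rw [hf₁, this]
      ring
    rw [h1, fiberSum_mul_coe H (fun g => f g * W g ^ θ) (fun x => F x ^ (q / 2 - 1)), ← hF]
    rcases eq_or_ne (F x) 0 with h0 | h0
    · rw [h0, zero_mul, ENNReal.zero_rpow_of_pos hq0]
      simp
    · rw [mul_pow, ← ENNReal.rpow_natCast, ← ENNReal.rpow_natCast, ← ENNReal.rpow_mul,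
        ← ENNReal.rpow_add _ _ h0 (hFt x)]
      congr 1
      push_cast
      ring
  -- The exponent q/2 - 1 is negative for q < 2, so the last factor is infinite where F vanishes;
  -- there f vanishes too, and 0 * ∞ = 0.
  have hf₁t : ∀ g, f₁ g ≠ ∞ := fun g => by
    rcases eq_or_ne (f g) 0 with h0 | h0
    · simp [hf₁, h0]
    · refine ENNReal.mul_ne_top (ENNReal.mul_ne_top (hf g) (hWrt g _)) ?_
      simp [ENNReal.rpow_eq_top_iff, hF0 g h0, hFt]
  have hf₁s : f₁.support.Finite := hfs.subset fun g hg h0 => hg (by simp [hf₁, h0])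
  have hterm : ∀ (g : G) (x : G ⧸ H), f g * ξ x =
      (f₀ g * ξ x ^ q) ^ (1 - θ) * (f₁ g * ξ x ^ (q / 2)) ^ θ := by
    intro g x
    rcases eq_or_ne (f g) 0 with h0 | h0
    · simp [hf₁, h0, ENNReal.zero_rpow_of_pos hθ0]
    rcases eq_or_ne (ξ x) 0 with h1 | h1
    · simp [h1, ENNReal.zero_rpow_of_pos hθ0, ENNReal.zero_rpow_of_pos (half_pos hq0)]
    have e1 : f g = f g ^ (1 - θ) * f g ^ θ := by
      rw [← ENNReal.rpow_add _ _ h0 (hf g)]; simp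
    have e2 : (W g ^ θ) ^ (1 - θ) * (W g ^ (θ - 1)) ^ θ = 1 := by
      rw [← ENNReal.rpow_mul, ← ENNReal.rpow_mul, ← ENNReal.rpow_add _ _ (hW0 g) (hWt g)]
      rw [show θ * (1 - θ) + (θ - 1) * θ = 0 by ring, ENNReal.rpow_zero]
    have e3 : (F g ^ (q - 1)) ^ (1 - θ) * (F g ^ (q / 2 - 1)) ^ θ = 1 := by
      rw [← ENNReal.rpow_mul, ← ENNReal.rpow_mul, ← ENNReal.rpow_add _ _ (hF0 g h0) (hFt g)]
      rw [show (q - 1) * (1 - θ) + (q / 2 - 1) * θ = 0 by linear_combination (-1 / 2) * hθq,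
        ENNReal.rpow_zero]
    have e4 : ξ x = (ξ x ^ q) ^ (1 - θ) * (ξ x ^ (q / 2)) ^ θ := by
      rw [← ENNReal.rpow_mul, ← ENNReal.rpow_mul, ← ENNReal.rpow_add _ _ h1 (hξ x)]
      rw [show q * (1 - θ) + q / 2 * θ = 1 by linear_combination (-1 / 2) * hθq,
        ENNReal.rpow_one]
    simp only [hf₀, hf₁, ENNReal.mul_rpow_of_nonneg _ _ hθ1', ENNReal.mul_rpow_of_nonneg _ _ hθ0.le]
    calc f g * ξ x = (f g ^ (1 - θ) * f g ^ θ) *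
          ((W g ^ θ) ^ (1 - θ) * (W g ^ (θ - 1)) ^ θ) *
          ((F g ^ (q - 1)) ^ (1 - θ) * (F g ^ (q / 2 - 1)) ^ θ) *
          ((ξ x ^ q) ^ (1 - θ) * (ξ x ^ (q / 2)) ^ θ) := by rw [e2, e3, ← e1, ← e4]; simp
      _ = _ := by ring
  set A := act H f₀ (fun x => ξ x ^ q) with hA
  set B := act H f₁ (fun x => ξ x ^ (q / 2)) with hB
  have hact : ∀ x, act H f ξ x ≤ A x ^ (1 - θ) * B x ^ θ := by
    intro x
    rw [act, tsum_congr fun g => hterm g (g⁻¹ • x)]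
    exact tsum_rpow_mul_rpow_le _ _ hθ1' hθ0.le (by ring)
  have hAsum : ∑' x, A x = (∑' x, F x ^ q) * ∑' x, ξ x ^ q := by
    rw [hA, tsum_act, hsum₀]
  have hBsum : ∑' x, B x ^ 2 ≤ ENNReal.ofReal C ^ 2 * (∑' x, F x ^ q) * ∑' x, ξ x ^ q := by
    have h := hRD.tsum_act_sq_le f₁ hf₁t hf₁s (fun x => ξ x ^ (q / 2))
      (fun x => ENNReal.rpow_ne_top_of_nonneg (by positivity) (hξ x))
      (hξs.subset fun x hx h0 => hx (by simp [h0, half_pos hq0]))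
    rw [tsum_congr hsum₁] at h
    refine h.trans_eq ?_
    congr 1
    refine tsum_congr fun x => ?_
    rw [← ENNReal.rpow_natCast, ← ENNReal.rpow_mul]
    congr 1
    push_cast
    ring
  have hcomb : ∀ a : ℝ≥0∞, a ^ (2 - q) * a ^ (q - 1) = a := fun a => by
    rw [← ENNReal.rpow_add_of_nonneg _ _ (by linarith) (by linarith)]
    rw [show 2 - q + (q - 1) = 1 by ring, ENNReal.rpow_one]
  -- Since (1-θ)q = 2-q and θq = 2(q-1), Hölder with exponents 2-q and q-1 separates the ℓ¹ norm of
  -- A from the squared ℓ² norm of B.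
  calc ∑' x, act H f ξ x ^ q
      ≤ ∑' x, A x ^ (2 - q) * (B x ^ 2) ^ (q - 1) := by
        refine ENNReal.tsum_le_tsum fun x => ?_
        refine (ENNReal.rpow_le_rpow (hact x) hq0.le).trans_eq ?_
        rw [ENNReal.mul_rpow_of_nonneg _ _ hq0.le, ← ENNReal.rpow_mul, ← ENNReal.rpow_mul, hθ1,
          hθq, ← ENNReal.rpow_natCast, ← ENNReal.rpow_mul]
        norm_num
    _ ≤ (∑' x, A x) ^ (2 - q) * (∑' x, B x ^ 2) ^ (q - 1) :=
        tsum_rpow_mul_rpow_le _ _ (by linarith) (by linarith) (by ring)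
    _ ≤ ((∑' x, F x ^ q) * ∑' x, ξ x ^ q) ^ (2 - q) *
        (ENNReal.ofReal C ^ 2 * (∑' x, F x ^ q) * ∑' x, ξ x ^ q) ^ (q - 1) := by
        rw [hAsum]
        gcongr
    _ = ENNReal.ofReal C ^ (2 * (q - 1)) * (∑' x, F x ^ q) * ∑' x, ξ x ^ q := by
        rw [mul_assoc (ENNReal.ofReal C ^ 2), ENNReal.mul_rpow_of_nonneg (ENNReal.ofReal C ^ 2) _
          (by linarith), ← ENNReal.rpow_natCast, ← ENNReal.rpow_mul, mul_left_comm, hcomb,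
          mul_assoc]
        norm_num

/-- Both sides are monotone in f and ξ, so finite supports are removed by exhaustion: finitely many
x and g involve only the finitely many values of ξ on `D`. -/
theorem PairRapidDecay.tsum_act_rpow_le {G : Type*} [Group G] {S : Finset G}
    {H : Subgroup G} {C s₁ : ℝ} (hRD : PairRapidDecay S H C s₁) {q : ℝ} (hq : 1 < q) (hq2 : q ≤ 2)
    (f : G → ℝ≥0∞) (hf : ∀ g, f g ≠ ∞) (ξ : G ⧸ H → ℝ≥0∞) (hξ : ∀ x, ξ x ≠ ∞) :
    ∑' x, act H f ξ x ^ q ≤ ENNReal.ofReal C ^ (2 * (q - 1)) *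
      (∑' x, fiberSum H (fun g => f g * lengthWeight S s₁ g ^ (2 * (q - 1) / q)) x ^ q) *
        ∑' x, ξ x ^ q := by
  classical
  have hq0 : 0 < q := by linarith
  rw [ENNReal.tsum_eq_iSup_sum]
  refine iSup_le fun A => ?_
  have hlim : Tendsto (fun B : Finset G => ∑ x ∈ A, (∑ g ∈ B, f g * ξ (g⁻¹ • x)) ^ q) atTop
      (𝓝 (∑ x ∈ A, act H f ξ x ^ q)) :=
    tendsto_finsetSum _ fun x _ =>
      (ENNReal.continuous_rpow_const.tendsto _).comp ENNReal.summable.hasSum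
  refine le_of_tendsto' hlim fun B => ?_
  set D : Finset (G ⧸ H) := Finset.image₂ (fun g x => g⁻¹ • x) B A with hD
  set f' : G → ℝ≥0∞ := fun g => if g ∈ B then f g else 0 with hf'
  set ξ' : G ⧸ H → ℝ≥0∞ := fun x => if x ∈ D then ξ x else 0 with hξ'
  have hle : ∀ g, f' g ≤ f g := fun g => by simp only [hf']; split_ifs <;> simp
  have hleξ : ∀ x, ξ' x ≤ ξ x := fun x => by simp only [hξ']; split_ifs <;> simp
  have h := hRD.tsum_act_rpow_le_of_finite hq hq2 f' (fun g => ne_top_of_le_ne_top (hf g) (hle g))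
    (B.finite_toSet.subset fun g hg => by
      by_contra h
      exact hg (if_neg fun h' => h (Finset.mem_coe.2 h'))) ξ'
    (fun x => ne_top_of_le_ne_top (hξ x) (hleξ x))
    (D.finite_toSet.subset fun x hx => by
      by_contra h
      exact hx (if_neg fun h' => h (Finset.mem_coe.2 h')))
  calc ∑ x ∈ A, (∑ g ∈ B, f g * ξ (g⁻¹ • x)) ^ q
      ≤ ∑ x ∈ A, act H f' ξ' x ^ q := by
        refine Finset.sum_le_sum fun x hx => ENNReal.rpow_le_rpow ?_ hq0.le
        refine le_trans (Finset.sum_le_sum fun g hg => ?_)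
          (ENNReal.sum_le_tsum (f := fun g => f' g * ξ' (g⁻¹ • x)) B)
        simp only [hf', hξ', if_pos hg]
        rw [if_pos (Finset.mem_image₂_of_mem hg hx)]
    _ ≤ ∑' x, act H f' ξ' x ^ q := ENNReal.sum_le_tsum A
    _ ≤ _ := h
    _ ≤ _ := by
        gcongr with x x
        · exact fiberSum_mono H (fun g => by gcongr; exact hle g) x
        · exact hleξ x

/-- Hölder on each fiber with respect to m, exponents 1-1/q and 1/q. The right side is an average
over m of a (q-1)-th power, which can be differentiated at q = 1. -/
theorem tsum_fiberSum_rpow_le {G : Type*} [Group G] (H : Subgroup G) (m W : G → ℝ≥0∞) {q : ℝ}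
    (hq : 1 < q) :
    ∑' x, fiberSum H (fun g => m g * W g ^ (2 * (q - 1) / q)) x ^ q ≤
      ∑' g : G, m g * W g ^ (2 * (q - 1)) * fiberSum H m g ^ (q - 1) := by
  have hq0 : 0 < q := by linarith
  have hqi : 0 ≤ 1 - 1 / q := by
    rw [sub_nonneg, div_le_one hq0]
    exact hq.le
  rw [← tsum_fiberSum_mul H (fun g => m g * W g ^ (2 * (q - 1))) (fun x => fiberSum H m x ^ (q - 1))]
  refine ENNReal.tsum_le_tsum fun x => ?_
  have h : fiberSum H (fun g => m g * W g ^ (2 * (q - 1) / q)) x ≤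
      fiberSum H m x ^ (1 - 1 / q) *
        fiberSum H (fun g => m g * W g ^ (2 * (q - 1))) x ^ (1 / q) := by
    refine le_trans (le_of_eq (tsum_congr fun g => ?_))
      (tsum_rpow_mul_rpow_le _ _ hqi (by positivity) (by ring))
    rw [ENNReal.mul_rpow_of_nonneg _ _ (by positivity), ← ENNReal.rpow_mul, ← mul_assoc,
      ← ENNReal.rpow_add_of_nonneg _ _ hqi (by positivity), sub_add_cancel, ENNReal.rpow_one,
      mul_one_div]
  refine (ENNReal.rpow_le_rpow h hq0.le).trans_eq ?_
  rw [ENNReal.mul_rpow_of_nonneg _ _ hq0.le, ← ENNReal.rpow_mul, ← ENNReal.rpow_mul,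
    one_div_mul_cancel hq0.ne', ENNReal.rpow_one, sub_mul, one_div_mul_cancel hq0.ne', one_mul,
    mul_comm]

/-! ### Convolution powers and the induced walk -/

theorem convPow_succ_apply {G : Type*} [Group G] (μ : PMF G) (n : ℕ) (g : G) :
    convPow μ (n + 1) g = ∑' s, μ s * convPow μ n (s⁻¹ * g) := by
  classical
  rw [convPow, PMF.bind_apply]
  refine tsum_congr fun s => ?_
  rw [PMF.map_apply, tsum_eq_single (s⁻¹ * g)]
  · simp
  · intro z hz
    rw [if_neg]
    rintro rfl
    simp at hz

theorem walkLaw_eq_map {G : Type*} [Group G] (H : Subgroup G) (μ : PMF G) (n : ℕ) :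
    walkLaw H μ n = PMF.map (fun g : G => (g : G ⧸ H)) (convPow μ n) := by
  -- In `walkLaw` the coercion to G/H acts on the measure as a monadic bind, followed by the
  -- identity map.
  change PMF.map id ((convPow μ n).bind fun a => PMF.pure (a : G ⧸ H)) = _
  rw [PMF.map_id]
  rfl

theorem walkLaw_apply {G : Type*} [Group G] (H : Subgroup G) (μ : PMF G) (n : ℕ) (x : G ⧸ H) :
    walkLaw H μ n x = fiberSum H (convPow μ n) x := by
  classical
  rw [walkLaw_eq_map, PMF.map_apply, fiberSum_eq_tsum_ite]
  exact tsum_congr fun g => by simp [eq_comm]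

theorem walkLaw_succ_apply {G : Type*} [Group G] (H : Subgroup G) (μ : PMF G) (n : ℕ)
    (x : G ⧸ H) : walkLaw H μ (n + 1) x = act H μ (walkLaw H μ n) x := by
  rw [walkLaw_apply, show (walkLaw H μ n : G ⧸ H → ℝ≥0∞) = fiberSum H (convPow μ n) from
    funext (walkLaw_apply H μ n), ← fiberSum_conv]
  simp only [fiberSum, convPow_succ_apply]

theorem walkLaw_zero {G : Type*} [Group G] (H : Subgroup G) (μ : PMF G) :
    walkLaw H μ 0 = PMF.pure ((1 : G) : G ⧸ H) := by
  rw [walkLaw_eq_map, convPow, PMF.pure_map]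

theorem act_convPow_zero {G : Type*} [Group G] (H : Subgroup G) (μ : PMF G)
    (ξ : G ⧸ H → ℝ≥0∞) : act H (convPow μ 0) ξ = ξ := by
  classical
  funext x
  rw [act, tsum_eq_single 1]
  · simp [convPow]
  · intro g hg
    simp [convPow, PMF.pure_apply, hg]

theorem act_convPow_succ {G : Type*} [Group G] (H : Subgroup G) (μ : PMF G) (n : ℕ)
    (ξ : G ⧸ H → ℝ≥0∞) :
    act H (convPow μ (n + 1)) ξ = act H μ (act H (convPow μ n) ξ) := by
  funext x
  simp only [act, convPow_succ_apply, ← ENNReal.tsum_mul_right, ← ENNReal.tsum_mul_left]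
  rw [ENNReal.tsum_comm]
  refine tsum_congr fun s => ?_
  rw [← (Equiv.mulLeft s).tsum_eq]
  refine tsum_congr fun g => ?_
  simp [mul_smul, mul_assoc]

/-- Repeating the single step g n times gives this bound. It keeps operator norms and spectral radii
away from 0, so that their logarithms are finite. -/
theorem pow_le_walkLaw {G : Type*} [Group G] (H : Subgroup G) (μ : PMF G) (g : G) (n : ℕ) :
    μ g ^ n ≤ walkLaw H μ n ((g ^ n : G) : G ⧸ H) := by
  classical
  induction n with
  | zero => simp [walkLaw_zero]
  | succ n ih =>
    rw [walkLaw_succ_apply]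
    refine le_trans ?_ (ENNReal.le_tsum g)
    have : g⁻¹ • ((g ^ (n + 1) : G) : G ⧸ H) = ((g ^ n : G) : G ⧸ H) := by
      rw [inv_smul_eq_iff, pow_succ']; rfl
    rw [this, pow_succ']
    gcongr

/-! ### The Markov operator and its powers -/

theorem summable_markovOp {G : Type*} [Group G] (H : Subgroup G) (q : ℝ≥0∞) [Fact (1 ≤ q)]
    (μ : PMF G) : Summable fun g => ((μ g).toReal : ℂ) • quasiRegular H q g := by
  refine Summable.of_norm_bounded (ENNReal.summable_toReal μ.tsum_coe_ne_top) fun g => ?_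
  rw [norm_smul, Complex.norm_real, Real.norm_of_nonneg ENNReal.toReal_nonneg]
  exact mul_le_of_le_one_right ENNReal.toReal_nonneg (LinearMap.mkContinuous_norm_le _ zero_le_one _)

/-- Evaluation at a point, as a continuous functional on `ℓ^q`. -/
def evalCLM {X : Type*} (q : ℝ≥0∞) [Fact (1 ≤ q)] (x : X) : ellq X q →L[ℂ] ℂ :=
  LinearMap.mkContinuous
    { toFun := fun ξ => ξ x
      map_add' := fun _ _ => rfl
      map_smul' := fun _ _ => rfl }
    1 (fun ξ => by
      rw [one_mul]
      exact lp.norm_apply_le_norm (zero_lt_one.trans_le Fact.out).ne' ξ x)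

theorem hasSum_markovOp_apply {G : Type*} [Group G] (H : Subgroup G) (q : ℝ≥0∞) [Fact (1 ≤ q)]
    (μ : PMF G) (ξ : ellq (G ⧸ H) q) (x : G ⧸ H) :
    HasSum (fun g => ((μ g).toReal : ℂ) * ξ (g⁻¹ • x)) (markovOp H q μ ξ x) := by
  have h := (summable_markovOp H q μ).hasSum
  have h2 := (h.mapL (ContinuousLinearMap.apply ℂ (ellq (G ⧸ H) q) ξ)).mapL (evalCLM q x)
  exact h2

theorem enorm_markovOp_apply_le {G : Type*} [Group G] (H : Subgroup G) (q : ℝ≥0∞) [Fact (1 ≤ q)]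
    (μ : PMF G) (ξ : ellq (G ⧸ H) q) (x : G ⧸ H) :
    ‖markovOp H q μ ξ x‖ₑ ≤ act H μ (fun x => ‖ξ x‖ₑ) x := by
  rw [← (hasSum_markovOp_apply H q μ ξ x).tsum_eq]
  refine (enorm_tsum_le_tsum_enorm).trans_eq (tsum_congr fun g => ?_)
  rw [enorm_mul, ← ofReal_norm (((μ g).toReal : ℂ)), Complex.norm_real,
    Real.norm_of_nonneg ENNReal.toReal_nonneg, ENNReal.ofReal_toReal (μ.apply_ne_top g)]

/-- Positivity of the kernel: bounds proved for nonnegative functions control the operator on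
complex ones. -/
theorem enorm_markovOp_pow_apply_le {G : Type*} [Group G] (H : Subgroup G) (q : ℝ≥0∞)
    [Fact (1 ≤ q)] (μ : PMF G) (n : ℕ) (ξ : ellq (G ⧸ H) q) (x : G ⧸ H) :
    ‖(markovOp H q μ ^ n) ξ x‖ₑ ≤ act H (convPow μ n) (fun x => ‖ξ x‖ₑ) x := by
  induction n generalizing x with
  | zero => rw [act_convPow_zero]; simp
  | succ n ih =>
    rw [act_convPow_succ, pow_succ', mul_apply_eq_comp]
    refine (enorm_markovOp_apply_le H q μ _ x).trans (ENNReal.tsum_le_tsum fun g => ?_)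
    gcongr
    exact ih _

open Classical in
theorem markovOp_pow_single {G : Type*} [Group G] (H : Subgroup G) (q : ℝ≥0∞)
    [Fact (1 ≤ q)] (μ : PMF G) (n : ℕ) (x : G ⧸ H) :
    (markovOp H q μ ^ n) (lp.single q ((1 : G) : G ⧸ H) (1 : ℂ)) x =
      (((walkLaw H μ n x).toReal : ℝ) : ℂ) := by
  induction n generalizing x with
  | zero =>
    rw [walkLaw_zero, PMF.pure_apply, pow_zero, one_apply_eq_self,
      lp.single_apply]
    by_cases h : x = ((1 : G) : G ⧸ H)
    · subst h; simp
    · simp [h]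
  | succ n ih =>
    rw [pow_succ', mul_apply_eq_comp,
      ← (hasSum_markovOp_apply H q μ _ x).tsum_eq, walkLaw_succ_apply, act,
      ENNReal.tsum_toReal_eq (fun g => ENNReal.mul_ne_top (μ.apply_ne_top g)
        ((walkLaw H μ n).apply_ne_top _)), Complex.ofReal_tsum]
    simp only [ih, ENNReal.toReal_mul, Complex.ofReal_mul]

theorem enorm_rpow_eq_tsum {X : Type*} {q : ℝ} (hq : 1 ≤ q) [Fact (1 ≤ ENNReal.ofReal q)]
    (ξ : ellq X (ENNReal.ofReal q)) : ‖ξ‖ₑ ^ q = ∑' x, ‖ξ x‖ₑ ^ q := by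
  have hq0 : 0 < q := by linarith
  have hqr : (ENNReal.ofReal q).toReal = q := ENNReal.toReal_ofReal hq0.le
  have h := lp.hasSum_norm (p := ENNReal.ofReal q) (by rw [hqr]; exact hq0) ξ
  rw [hqr] at h
  rw [← ofReal_norm, ENNReal.ofReal_rpow_of_nonneg (norm_nonneg _) hq0.le, ← h.tsum_eq,
    ENNReal.ofReal_tsum_of_nonneg (fun x => by positivity) h.summable]
  refine tsum_congr fun x => ?_
  rw [← ofReal_norm, ENNReal.ofReal_rpow_of_nonneg (norm_nonneg _) hq0.le]

open Classical in
/-- The operator norm of the `n`-th power of the Markov operator on `ℓ^q(G/H)`, `q ≥ 1`. -/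
def markovPowNorm {G : Type*} [Group G] (H : Subgroup G) (μ : PMF G) (q : ℝ) (n : ℕ) : ℝ≥0∞ :=
  if h : 1 ≤ ENNReal.ofReal q then
    haveI : Fact (1 ≤ ENNReal.ofReal q) := ⟨h⟩
    ‖markovOp H (ENNReal.ofReal q) μ ^ n‖ₑ
  else 0

/-- The point mass at the base point is a unit vector of ℓ^q, and the n-th power of the operator
sends it to ν_n. -/
theorem tsum_walkLaw_rpow_le {G : Type*} [Group G] (H : Subgroup G) (μ : PMF G) {q : ℝ}
    (hq : 1 ≤ q) (n : ℕ) : ∑' x, walkLaw H μ n x ^ q ≤ markovPowNorm H μ q n ^ q := by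
  classical
  have hq0 : 0 < q := by linarith
  have h1 : 1 ≤ ENNReal.ofReal q := by simpa using hq
  have : Fact (1 ≤ ENNReal.ofReal q) := ⟨h1⟩
  rw [markovPowNorm, dif_pos h1]
  set T := markovOp H (ENNReal.ofReal q) μ ^ n
  set δ : ellq (G ⧸ H) (ENNReal.ofReal q) := lp.single _ ((1 : G) : G ⧸ H) (1 : ℂ)
  have h2 : ‖T δ‖ₑ ^ q = ∑' x, walkLaw H μ n x ^ q := by
    rw [enorm_rpow_eq_tsum hq]
    refine tsum_congr fun x => ?_
    rw [markovOp_pow_single, ← ofReal_norm, Complex.norm_real,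
      Real.norm_of_nonneg ENNReal.toReal_nonneg, ENNReal.ofReal_toReal
        ((walkLaw H μ n).apply_ne_top _)]
  have hδ : ‖δ‖ₑ = 1 := by
    rw [← ofReal_norm, lp.norm_single (by simpa using hq0)]
    simp
  rw [← h2]
  refine ENNReal.rpow_le_rpow ?_ hq0.le
  have := T.le_opENorm δ
  rwa [hδ, mul_one] at this

theorem markovPowNorm_rpow_le {G : Type*} [Group G] (H : Subgroup G) (μ : PMF G) {q : ℝ}
    (hq : 1 ≤ q) (n : ℕ) {K : ℝ≥0∞}
    (hK : ∀ ξ : G ⧸ H → ℝ≥0∞, (∀ x, ξ x ≠ ∞) →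
      ∑' x, act H (convPow μ n) ξ x ^ q ≤ K * ∑' x, ξ x ^ q) :
    markovPowNorm H μ q n ^ q ≤ K := by
  rcases eq_or_ne K ∞ with rfl | hKt
  · exact le_top
  have hq0 : 0 < q := by linarith
  have h1 : 1 ≤ ENNReal.ofReal q := by simpa using hq
  have : Fact (1 ≤ ENNReal.ofReal q) := ⟨h1⟩
  rw [markovPowNorm, dif_pos h1, ← ENNReal.le_rpow_inv_iff hq0]
  have hKt' : K ^ q⁻¹ ≠ ∞ := ENNReal.rpow_ne_top_of_nonneg (by positivity) hKt
  rw [← ofReal_norm, ENNReal.ofReal_le_iff_le_toReal hKt']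
  refine ContinuousLinearMap.opNorm_le_bound _ ENNReal.toReal_nonneg fun ξ => ?_
  set T := markovOp H (ENNReal.ofReal q) μ ^ n
  have h2 : ‖T ξ‖ₑ ^ q ≤ K * ‖ξ‖ₑ ^ q := by
    rw [enorm_rpow_eq_tsum hq, enorm_rpow_eq_tsum hq]
    refine le_trans (ENNReal.tsum_le_tsum fun x => ?_) (hK (fun x => ‖ξ x‖ₑ) fun x => enorm_ne_top)
    exact ENNReal.rpow_le_rpow (enorm_markovOp_pow_apply_le H _ μ n ξ x) hq0.le
  have h3 : ‖T ξ‖ₑ ≤ K ^ q⁻¹ * ‖ξ‖ₑ := by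
    rw [← ENNReal.rpow_le_rpow_iff hq0, ENNReal.mul_rpow_of_nonneg _ _ hq0.le, ← ENNReal.rpow_mul,
      inv_mul_cancel₀ hq0.ne', ENNReal.rpow_one]
    exact h2
  have h4 := ENNReal.toReal_mono (ENNReal.mul_ne_top hKt' enorm_ne_top) h3
  simpa using h4

theorem markovPowNorm_ne_top {G : Type*} [Group G] (H : Subgroup G) (μ : PMF G) (q : ℝ) (n : ℕ) :
    markovPowNorm H μ q n ≠ ∞ := by
  rw [markovPowNorm]
  split_ifs <;> simp

theorem pow_le_markovPowNorm {G : Type*} [Group G] (H : Subgroup G) (μ : PMF G) {q : ℝ}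
    (hq : 1 ≤ q) (g : G) (n : ℕ) : μ g ^ n ≤ markovPowNorm H μ q n := by
  have hq0 : 0 < q := by linarith
  rw [← ENNReal.rpow_le_rpow_iff hq0]
  exact (ENNReal.rpow_le_rpow (pow_le_walkLaw H μ g n) hq0.le).trans
    ((ENNReal.le_tsum (f := fun x => walkLaw H μ n x ^ q) _).trans (tsum_walkLaw_rpow_le H μ hq n))

/-! ### The spectral radius -/

theorem tendsto_markovPowNorm {G : Type*} [Group G] (H : Subgroup G) (μ : PMF G) {q : ℝ}
    (hq : 1 ≤ q) :
    Tendsto (fun n : ℕ => markovPowNorm H μ q n ^ (1 / n : ℝ)) atTop (𝓝 (specRad H μ q)) := by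
  have h1 : 1 ≤ ENNReal.ofReal q := by simpa using hq
  have : Fact (1 ≤ ENNReal.ofReal q) := ⟨h1⟩
  simp only [markovPowNorm, specRad, dif_pos h1]
  exact spectrum.pow_nnnorm_pow_one_div_tendsto_nhds_spectralRadius _

theorem specRad_le_markovPowNorm {G : Type*} [Group G] (H : Subgroup G) (μ : PMF G) {q : ℝ}
    (hq : 1 ≤ q) {n : ℕ} (hn : n ≠ 0) :
    specRad H μ q ≤ markovPowNorm H μ q n ^ (1 / n : ℝ) := by
  have h1 : 1 ≤ ENNReal.ofReal q := by simpa using hq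
  have : Fact (1 ≤ ENNReal.ofReal q) := ⟨h1⟩
  simp only [markovPowNorm, specRad, dif_pos h1]
  obtain ⟨k, rfl⟩ := Nat.exists_eq_succ_of_ne_zero hn
  refine (spectrum.spectralRadius_le_pow_nnnorm_pow_one_div ℂ
    (markovOp H (ENNReal.ofReal q) μ) k).trans ?_
  have h2 : ((‖(1 : ellq (G ⧸ H) (ENNReal.ofReal q) →L[ℂ] ellq (G ⧸ H) (ENNReal.ofReal q))‖₊ :
      ℝ≥0∞)) ^ (1 / (k + 1) : ℝ) ≤ 1 := by
    refine ENNReal.rpow_le_one ?_ (by positivity)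
    exact_mod_cast ContinuousLinearMap.norm_id_le
  refine (mul_le_of_le_one_right' h2).trans_eq ?_
  simp [enorm_eq_nnnorm]

theorem exists_le_specRad {G : Type*} [Group G] (H : Subgroup G) (μ : PMF G) :
    ∃ c : ℝ≥0∞, 0 < c ∧ ∀ q : ℝ, 1 ≤ q → c ≤ specRad H μ q := by
  obtain ⟨g, hg⟩ := μ.support_nonempty
  refine ⟨μ g, (μ.apply_pos_iff g).2 hg, fun q hq => ?_⟩
  refine ge_of_tendsto (tendsto_markovPowNorm H μ hq) ?_
  filter_upwards [eventually_ne_atTop 0] with n hn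
  refine le_trans (le_of_eq ?_) (ENNReal.rpow_le_rpow (pow_le_markovPowNorm H μ hq g n)
    (by positivity))
  rw [← ENNReal.rpow_natCast, ← ENNReal.rpow_mul, mul_one_div_cancel (by exact_mod_cast hn),
    ENNReal.rpow_one]

/-! ### Jensen's inequality and the geometric mean for probability mass functions -/

theorem summable_toReal_pmf {ι : Type*} (p : PMF ι) : Summable fun i => (p i).toReal :=
  ENNReal.summable_toReal p.tsum_coe_ne_top

theorem tsum_toReal_pmf {ι : Type*} (p : PMF ι) : ∑' i, (p i).toReal = 1 := by
  rw [← ENNReal.tsum_toReal_eq p.apply_ne_top, p.tsum_coe, ENNReal.toReal_one]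

theorem tsum_mul_pos {ι : Type*} (p : PMF ι) {Y : ι → ℝ} (hY : ∀ i, p i ≠ 0 → 0 < Y i)
    (h1 : Summable fun i => (p i).toReal * Y i) : 0 < ∑' i, (p i).toReal * Y i := by
  obtain ⟨i, hi⟩ := p.support_nonempty
  rw [PMF.mem_support_iff] at hi
  refine h1.tsum_pos (fun j => ?_) i (mul_pos (ENNReal.toReal_pos hi (p.apply_ne_top i)) (hY i hi))
  rcases eq_or_ne (p j) 0 with h | h
  · simp [h]
  · exact mul_nonneg ENNReal.toReal_nonneg (hY j h).le

/-- Jensen's inequality, obtained by averaging the tangent-line bound log(Y/E) ≤ Y/E - 1 at the mean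
E. -/
theorem tsum_mul_log_le_log_tsum {ι : Type*} (p : PMF ι) {Y : ι → ℝ}
    (hY : ∀ i, p i ≠ 0 → 0 < Y i) (h1 : Summable fun i => (p i).toReal * Y i)
    (h2 : Summable fun i => (p i).toReal * Real.log (Y i)) :
    ∑' i, (p i).toReal * Real.log (Y i) ≤ Real.log (∑' i, (p i).toReal * Y i) := by
  set E := ∑' i, (p i).toReal * Y i with hE
  have hE0 : 0 < E := tsum_mul_pos p hY h1
  have hp := summable_toReal_pmf p
  have h3 : Summable fun i => (p i).toReal * Y i * E⁻¹ + (p i).toReal * (Real.log E - 1) :=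
    (h1.mul_right _).add (hp.mul_right _)
  have h4 : ∑' i, ((p i).toReal * Y i * E⁻¹ + (p i).toReal * (Real.log E - 1)) = Real.log E := by
    rw [(h1.mul_right _).tsum_add (hp.mul_right _), tsum_mul_right, tsum_mul_right, ← hE,
      tsum_toReal_pmf, mul_inv_cancel₀ hE0.ne']
    ring
  rw [← h4]
  refine h2.tsum_le_tsum (fun i => ?_) h3
  rcases eq_or_ne (p i) 0 with h | h
  · simp [h]
  have h5 := Real.log_le_sub_one_of_pos (mul_pos (hY i h) (inv_pos.2 hE0))
  rw [Real.log_mul (hY i h).ne' (inv_pos.2 hE0).ne', Real.log_inv] at h5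
  have h6 : Real.log (Y i) ≤ Y i * E⁻¹ + (Real.log E - 1) := by linarith
  have := mul_le_mul_of_nonneg_left h6 (ENNReal.toReal_nonneg (a := p i))
  linarith

theorem log_le_rpow_sub_one_div {y ε : ℝ} (hy : 0 < y) (hε : 0 < ε) :
    Real.log y ≤ (y ^ ε - 1) / ε := by
  rw [le_div_iff₀ hε, Real.rpow_def_of_pos hy]
  linarith [Real.add_one_le_exp (Real.log y * ε)]

theorem rpow_sub_one_div_le {y ε : ℝ} (hy : 0 < y) (hε : 0 < ε) (hε1 : ε ≤ 1) :
    (y ^ ε - 1) / ε ≤ y - 1 := by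
  have h := rpow_one_add_le_one_add_mul_self (s := y - 1) (by linarith) hε.le hε1
  rw [div_le_iff₀ hε]
  rw [add_sub_cancel] at h
  linarith

theorem tendsto_rpow_sub_one_div {y : ℝ} (hy : 0 < y) :
    Tendsto (fun ε : ℝ => (y ^ ε - 1) / ε) (𝓝[>] 0) (𝓝 (Real.log y)) := by
  have h := (Real.hasStrictDerivAt_const_rpow hy 0).hasDerivAt.tendsto_slope_zero_right
  simp only [zero_add, Real.rpow_zero, one_mul, smul_eq_mul] at h
  exact h.congr fun t => by rw [div_eq_inv_mul]

/-- The derivative at 0 of ε ↦ E[Y^ε]. Since log y ≤ (y^ε - 1)/ε ≤ y - 1 for 0 < ε ≤ 1, the sum |log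
Y| + |Y - 1| is an integrable majorant. -/
theorem tendsto_tsum_rpow_sub_one_div {ι : Type*} (p : PMF ι) {Y : ι → ℝ}
    (hY : ∀ i, p i ≠ 0 → 0 < Y i) (h1 : Summable fun i => (p i).toReal * Y i)
    (h2 : Summable fun i => (p i).toReal * Real.log (Y i)) :
    Tendsto (fun ε : ℝ => ∑' i, (p i).toReal * ((Y i ^ ε - 1) / ε)) (𝓝[>] 0)
      (𝓝 (∑' i, (p i).toReal * Real.log (Y i))) := by
  have hp := summable_toReal_pmf p
  have h3 : Summable fun i => (p i).toReal * (Y i - 1) := by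
    simpa only [mul_sub, mul_one] using h1.sub hp
  refine tendsto_tsum_of_dominated_convergence (h2.abs.add h3.abs) (fun i => ?_) ?_
  · rcases eq_or_ne (p i) 0 with h | h
    · simp [h]
    · exact (tendsto_rpow_sub_one_div (hY i h)).const_mul _
  · filter_upwards [Ioc_mem_nhdsGT (zero_lt_one' ℝ)] with ε hε i
    rcases eq_or_ne (p i) 0 with h | h
    · simp [h]
    have hpi := ENNReal.toReal_nonneg (a := p i)
    have l1 := mul_le_mul_of_nonneg_left (log_le_rpow_sub_one_div (hY i h) hε.1) hpi
    have l2 := mul_le_mul_of_nonneg_left (rpow_sub_one_div_le (hY i h) hε.1 hε.2) hpi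
    rw [Real.norm_eq_abs]
    refine abs_le.2 ⟨?_, ?_⟩
    · linarith [neg_abs_le ((p i).toReal * Real.log (Y i)), abs_nonneg ((p i).toReal * (Y i - 1))]
    · linarith [le_abs_self ((p i).toReal * (Y i - 1)), abs_nonneg ((p i).toReal * Real.log (Y i))]

/-! ### Shannon entropy of the walk -/

/-- The information content `-log t` of an event of probability `t`. -/
def surprisal (t : ℝ≥0∞) : ℝ≥0∞ := ENNReal.ofReal (-Real.log t.toReal)

theorem surprisal_anti {s t : ℝ≥0∞} (hs : s ≠ 0) (ht : t ≠ ∞) (h : s ≤ t) :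
    surprisal t ≤ surprisal s := by
  refine ENNReal.ofReal_le_ofReal (neg_le_neg (Real.log_le_log ?_ (ENNReal.toReal_mono ht h)))
  exact ENNReal.toReal_pos hs (ne_top_of_le_ne_top ht h)

theorem surprisal_mul_le {s t : ℝ≥0∞} (hs : s ≠ 0) (ht : t ≠ 0) (hs' : s ≠ ∞) (ht' : t ≠ ∞) :
    surprisal (s * t) ≤ surprisal s + surprisal t := by
  rw [surprisal, ENNReal.toReal_mul, Real.log_mul (ENNReal.toReal_pos hs hs').ne'
    (ENNReal.toReal_pos ht ht').ne', neg_add]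
  exact ENNReal.ofReal_add_le

theorem shannonEntropy_eq_tsum_surprisal {X : Type*} (ν : PMF X) :
    shannonEntropy ν = ∑' x, ν x * surprisal (ν x) := by
  refine tsum_congr fun x => ?_
  rw [surprisal, Real.negMulLog, neg_mul_comm, ENNReal.ofReal_mul ENNReal.toReal_nonneg,
    ENNReal.ofReal_toReal (ν.apply_ne_top x)]

/-- From ν_{n+1}(sx) ≥ μ(s) ν_n(x), the surprisal after one more step is at most the sum of the two
surprisals; averaging gives H(ν_{n+1}) ≤ H(μ) + H(ν_n). -/
theorem shannonEntropy_walkLaw_le {G : Type*} [Group G] (H : Subgroup G) (μ : PMF G) (n : ℕ) :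
    shannonEntropy (walkLaw H μ n) ≤ n * shannonEntropy μ := by
  classical
  induction n with
  | zero =>
    rw [walkLaw_zero, shannonEntropy]
    simp only [PMF.pure_apply, Nat.cast_zero, zero_mul, nonpos_iff_eq_zero, ENNReal.tsum_eq_zero]
    intro x
    split_ifs <;> simp
  | succ n ih =>
    set ν := walkLaw H μ n
    have hstep : shannonEntropy (walkLaw H μ (n + 1)) ≤
        ∑' s, ∑' x, (μ s * surprisal (μ s) * ν x + μ s * (ν x * surprisal (ν x))) := by
      rw [shannonEntropy_eq_tsum_surprisal]
      simp only [walkLaw_succ_apply]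
      rw [tsum_act_mul]
      refine ENNReal.tsum_le_tsum fun s => ENNReal.tsum_le_tsum fun x => ?_
      change μ s * ν x * surprisal (act H μ ν (s • x)) ≤ _
      rcases eq_or_ne (μ s) 0 with h | h
      · simp [h]
      rcases eq_or_ne (ν x) 0 with h' | h'
      · simp [h']
      have h1 : μ s * ν x ≤ act H μ ν (s • x) := by
        refine le_trans (le_of_eq ?_) (ENNReal.le_tsum s)
        rw [inv_smul_smul]
      have h2 : act H μ ν (s • x) ≠ ∞ := by
        rw [← walkLaw_succ_apply]
        exact PMF.apply_ne_top _ _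
      calc μ s * ν x * surprisal (act H μ ν (s • x))
          ≤ μ s * ν x * (surprisal (μ s) + surprisal (ν x)) := by
            gcongr
            exact (surprisal_anti (mul_ne_zero h h') h2 h1).trans
              (surprisal_mul_le h h' (μ.apply_ne_top s) (ν.apply_ne_top x))
        _ = _ := by ring
    refine hstep.trans ?_
    simp only [ENNReal.tsum_add, ENNReal.tsum_mul_left, ENNReal.tsum_mul_right, PMF.tsum_coe,
      mul_one, one_mul, ← shannonEntropy_eq_tsum_surprisal]
    push_cast
    rw [add_mul, one_mul, add_comm]
    gcongr

/-! ### Word length and moments -/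

theorem exists_list_prod_eq {G : Type*} [Group G] {S : Finset G} (hS : ∀ s ∈ S, s⁻¹ ∈ S)
    (hgen : Subgroup.closure (S : Set G) = ⊤) (g : G) :
    ∃ l : List G, (∀ s ∈ l, s ∈ S) ∧ l.prod = g := by
  have hg : g ∈ Subgroup.closure (S : Set G) := hgen ▸ Subgroup.mem_top g
  rw [← Subgroup.mem_toSubmonoid, Subgroup.closure_toSubmonoid] at hg
  obtain ⟨l, hl, rfl⟩ := Submonoid.exists_list_of_mem_closure hg
  refine ⟨l, fun s hs => ?_, rfl⟩
  rcases hl s hs with h | h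
  · exact h
  · simpa using hS _ h

theorem wordLength_mul_le {G : Type*} [Group G] {S : Finset G} (hS : ∀ s ∈ S, s⁻¹ ∈ S)
    (hgen : Subgroup.closure (S : Set G) = ⊤) (g h : G) :
    wordLength S (g * h) ≤ wordLength S g + wordLength S h := by
  have key : ∀ g : G, ∃ l : List G, (∀ s ∈ l, s ∈ S) ∧ l.prod = g ∧ l.length = wordLength S g :=
    fun g => Nat.sInf_mem (s := {n | ∃ l : List G, (∀ s ∈ l, s ∈ S) ∧ l.prod = g ∧ l.length = n})
      (by obtain ⟨l, h1, h2⟩ := exists_list_prod_eq hS hgen g; exact ⟨l.length, l, h1, h2, rfl⟩)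
  obtain ⟨l, hl, hl2, hl3⟩ := key g
  obtain ⟨k, hk, hk2, hk3⟩ := key h
  refine Nat.sInf_le ⟨l ++ k, fun s hs => ?_, by simp [hl2, hk2], by simp [hl3, hk3]⟩
  rcases List.mem_append.1 hs with h | h
  exacts [hl s h, hk s h]

theorem wordLength_one {G : Type*} [Group G] (S : Finset G) : wordLength S 1 = 0 :=
  Nat.le_zero.1 (Nat.sInf_le ⟨[], by simp⟩)

theorem lengthWeight_one {G : Type*} [Group G] (S : Finset G) (s : ℝ) :
    lengthWeight S s 1 = 1 := by
  simp [lengthWeight, wordLength_one]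

theorem lengthWeight_mul_le {G : Type*} [Group G] {S : Finset G} (hS : ∀ s ∈ S, s⁻¹ ∈ S)
    (hgen : Subgroup.closure (S : Set G) = ⊤) {s : ℝ} (hs : 0 ≤ s) (g h : G) :
    lengthWeight S s (g * h) ≤ lengthWeight S s g * lengthWeight S s h := by
  rw [lengthWeight, lengthWeight, lengthWeight, ← ENNReal.ofReal_mul (by positivity),
    ← Real.mul_rpow (by positivity) (by positivity)]
  have h1 : (wordLength S (g * h) : ℝ) ≤ wordLength S g + wordLength S h := by
    exact_mod_cast wordLength_mul_le hS hgen g h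
  gcongr
  nlinarith [mul_nonneg (Nat.cast_nonneg (α := ℝ) (wordLength S g))
    (Nat.cast_nonneg (α := ℝ) (wordLength S h))]

theorem lengthWeight_mul_le_add {G : Type*} [Group G] {S : Finset G} (hS : ∀ s ∈ S, s⁻¹ ∈ S)
    (hgen : Subgroup.closure (S : Set G) = ⊤) {s : ℝ} (hs : 0 ≤ s) (hs1 : s ≤ 1) (g h : G) :
    lengthWeight S s (g * h) ≤ lengthWeight S s g + lengthWeight S s h := by
  rw [lengthWeight, lengthWeight, lengthWeight, ← ENNReal.ofReal_add (by positivity) (by positivity)]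
  have h1 : (wordLength S (g * h) : ℝ) ≤ wordLength S g + wordLength S h := by
    exact_mod_cast wordLength_mul_le hS hgen g h
  refine ENNReal.ofReal_le_ofReal (le_trans ?_
    (Real.rpow_add_le_add_rpow (p := s) (by positivity) (by positivity) hs hs1))
  exact Real.rpow_le_rpow (by positivity) (by linarith) hs

theorem tsum_convPow_succ_mul {G : Type*} [Group G] (μ : PMF G) (n : ℕ) (φ : G → ℝ≥0∞) :
    ∑' g, convPow μ (n + 1) g * φ g = ∑' s, ∑' z, μ s * convPow μ n z * φ (s * z) := by
  simp only [convPow_succ_apply, ← ENNReal.tsum_mul_right]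
  rw [ENNReal.tsum_comm]
  refine tsum_congr fun s => ?_
  rw [← (Equiv.mulLeft s).tsum_eq]
  simp

theorem tsum_convPow_zero_mul {G : Type*} [Group G] (μ : PMF G) (φ : G → ℝ≥0∞) :
    ∑' g, convPow μ 0 g * φ g = φ 1 := by
  classical
  rw [tsum_eq_single 1]
  · simp [convPow]
  · intro g hg
    simp [convPow, PMF.pure_apply, hg]

/-- The bound is exponential in n but valid for every exponent s ≥ 0; it serves only to show that
moments of μ^{*n} are finite. -/
theorem tsum_convPow_mul_lengthWeight_le_pow {G : Type*} [Group G] {S : Finset G}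
    (hS : ∀ s ∈ S, s⁻¹ ∈ S) (hgen : Subgroup.closure (S : Set G) = ⊤) (μ : PMF G) {s : ℝ}
    (hs : 0 ≤ s) (n : ℕ) :
    ∑' g, convPow μ n g * lengthWeight S s g ≤ (∑' g, μ g * lengthWeight S s g) ^ n := by
  induction n with
  | zero => simp [tsum_convPow_zero_mul, lengthWeight_one]
  | succ n ih =>
    rw [tsum_convPow_succ_mul]
    calc ∑' t, ∑' z, μ t * convPow μ n z * lengthWeight S s (t * z)
        ≤ ∑' t, ∑' z, (μ t * lengthWeight S s t) * (convPow μ n z * lengthWeight S s z) := by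
          refine ENNReal.tsum_le_tsum fun t => ENNReal.tsum_le_tsum fun z => ?_
          rw [mul_mul_mul_comm]
          gcongr
          exact lengthWeight_mul_le hS hgen hs t z
      _ ≤ _ := by
          simp only [ENNReal.tsum_mul_left, ENNReal.tsum_mul_right]
          rw [pow_succ']
          gcongr

/-- For s ≤ 1 the weight is subadditive, so the moment grows only linearly; this makes the mean of
log(1+ℓ) grow at most logarithmically. -/
theorem tsum_convPow_mul_lengthWeight_le_mul {G : Type*} [Group G] {S : Finset G}
    (hS : ∀ s ∈ S, s⁻¹ ∈ S) (hgen : Subgroup.closure (S : Set G) = ⊤) (μ : PMF G) {s : ℝ}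
    (hs : 0 ≤ s) (hs1 : s ≤ 1) (n : ℕ) :
    ∑' g, convPow μ n g * lengthWeight S s g ≤ 1 + n * ∑' g, μ g * lengthWeight S s g := by
  induction n with
  | zero => simp [tsum_convPow_zero_mul, lengthWeight_one]
  | succ n ih =>
    rw [tsum_convPow_succ_mul]
    calc ∑' t, ∑' z, μ t * convPow μ n z * lengthWeight S s (t * z)
        ≤ ∑' t, ∑' z, (μ t * lengthWeight S s t * convPow μ n z +
            μ t * (convPow μ n z * lengthWeight S s z)) := by
          refine ENNReal.tsum_le_tsum fun t => ENNReal.tsum_le_tsum fun z => ?_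
          refine (mul_le_mul_right (lengthWeight_mul_le_add hS hgen hs hs1 t z) _).trans_eq ?_
          ring
      _ ≤ _ := by
          simp only [ENNReal.tsum_add, ENNReal.tsum_mul_left, ENNReal.tsum_mul_right,
            PMF.tsum_coe, mul_one, one_mul]
          refine (add_le_add_right ih _).trans_eq ?_
          push_cast
          ring

/-! ### Real-valued entropies -/

theorem summable_toReal_mul_log {X : Type*} (ν : PMF X) (h : shannonEntropy ν ≠ ∞) :
    Summable fun x => (ν x).toReal * Real.log (ν x).toReal := by
  have h1 := ENNReal.summable_toReal h
  refine h1.neg.congr fun x => ?_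
  rw [ENNReal.toReal_ofReal, Real.negMulLog, neg_mul, neg_neg]
  exact Real.negMulLog_nonneg ENNReal.toReal_nonneg
    (ENNReal.toReal_le_of_le_ofReal zero_le_one (by simpa using ν.coe_le_one x))

theorem toReal_shannonEntropy {X : Type*} (ν : PMF X) :
    (shannonEntropy ν).toReal = -∑' x, (ν x).toReal * Real.log (ν x).toReal := by
  rw [shannonEntropy, ENNReal.tsum_toReal_eq fun x => ENNReal.ofReal_ne_top, ← tsum_neg]
  refine tsum_congr fun x => ?_
  rw [ENNReal.toReal_ofReal, Real.negMulLog, neg_mul]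
  exact Real.negMulLog_nonneg ENNReal.toReal_nonneg
    (ENNReal.toReal_le_of_le_ofReal zero_le_one (by simpa using ν.coe_le_one x))

theorem tsum_rpow_le_one {X : Type*} (ν : PMF X) {α : ℝ} (hα : 1 ≤ α) : ∑' x, ν x ^ α ≤ 1 := by
  rw [← ν.tsum_coe]
  exact ENNReal.tsum_le_tsum fun x => ENNReal.rpow_le_self_of_le_one (ν.coe_le_one x) hα

theorem tsum_rpow_ne_top {X : Type*} (ν : PMF X) {α : ℝ} (hα : 1 ≤ α) : ∑' x, ν x ^ α ≠ ∞ :=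
  ((tsum_rpow_le_one ν hα).trans_lt ENNReal.one_lt_top).ne

theorem tsum_rpow_ne_zero {X : Type*} (ν : PMF X) {α : ℝ} (hα : 0 ≤ α) : ∑' x, ν x ^ α ≠ 0 := by
  obtain ⟨x, hx⟩ := ν.support_nonempty
  rw [PMF.mem_support_iff] at hx
  intro h
  have := ENNReal.tsum_eq_zero.1 h x
  rw [ENNReal.rpow_eq_zero_iff] at this
  rcases this with h | h
  · exact hx h.1
  · linarith [h.2]

theorem renyiEntropy_eq_coe {X : Type*} (ν : PMF X) {α : ℝ} (hα : 1 ≤ α) :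
    renyiEntropy α ν = ((1 / (1 - α) * Real.log (∑' x, ν x ^ α).toReal : ℝ) : EReal) := by
  rw [renyiEntropy, ENNReal.log_pos_real (tsum_rpow_ne_zero ν (by linarith))
    (tsum_rpow_ne_top ν hα), EReal.coe_mul]

/-- Rényi entropy of order `α > 1` is at most Shannon entropy. -/
theorem renyi_le_shannon {X : Type*} (ν : PMF X) (h : shannonEntropy ν ≠ ∞) {α : ℝ} (hα : 1 < α) :
    1 / (1 - α) * Real.log (∑' x, ν x ^ α).toReal ≤ (shannonEntropy ν).toReal := by
  have hsum : (∑' x, ν x ^ α).toReal = ∑' x, (ν x).toReal * (ν x).toReal ^ (α - 1) := by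
    rw [ENNReal.tsum_toReal_eq fun x =>
      ENNReal.rpow_ne_top_of_nonneg (by linarith) (ν.apply_ne_top x)]
    refine tsum_congr fun x => ?_
    rw [← ENNReal.toReal_rpow]
    conv_rhs => rw [← Real.rpow_one (ν x).toReal, ← Real.rpow_mul ENNReal.toReal_nonneg, one_mul]
    rw [← Real.rpow_add_of_nonneg ENNReal.toReal_nonneg zero_le_one (by linarith)]
    congr 1
    ring
  have hpos : ∀ x, ν x ≠ 0 → 0 < (ν x).toReal := fun x hx => ENNReal.toReal_pos hx (ν.apply_ne_top x)
  have hlog : ∀ x, (ν x).toReal * Real.log ((ν x).toReal ^ (α - 1)) =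
      (α - 1) * ((ν x).toReal * Real.log (ν x).toReal) := fun x => by
    rcases eq_or_ne (ν x) 0 with h0 | h0
    · simp [h0]
    · rw [Real.log_rpow (hpos x h0)]
      ring
  have hJ := tsum_mul_log_le_log_tsum ν (Y := fun x => (ν x).toReal ^ (α - 1))
    (fun x hx => Real.rpow_pos_of_pos (hpos x hx) _)
    (by
      refine Summable.of_nonneg_of_le (fun x => by positivity) (fun x => ?_) (summable_toReal_pmf ν)
      refine mul_le_of_le_one_right ENNReal.toReal_nonneg (Real.rpow_le_one ENNReal.toReal_nonneg
        (ENNReal.toReal_le_of_le_ofReal zero_le_one (by simpa using ν.coe_le_one x)) (by linarith)))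
    (((summable_toReal_mul_log ν h).mul_left (α - 1)).congr fun x => (hlog x).symm)
  rw [tsum_congr hlog, tsum_mul_left, ← hsum] at hJ
  rw [toReal_shannonEntropy, one_div_mul_eq_div, div_le_iff_of_neg (by linarith)]
  linarith

/-! ### Logarithmic bounds for the Markov operator -/

theorem markovPowNorm_ne_zero {G : Type*} [Group G] (H : Subgroup G) (μ : PMF G) {q : ℝ}
    (hq : 1 ≤ q) (n : ℕ) : markovPowNorm H μ q n ≠ 0 := by
  obtain ⟨g, hg⟩ := μ.support_nonempty
  rw [PMF.mem_support_iff] at hg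
  exact ((pos_iff_ne_zero.2 (pow_ne_zero n hg)).trans_le (pow_le_markovPowNorm H μ hq g n)).ne'

theorem specRad_ne_zero {G : Type*} [Group G] (H : Subgroup G) (μ : PMF G) {q : ℝ}
    (hq : 1 ≤ q) : specRad H μ q ≠ 0 := by
  obtain ⟨c, hc, h⟩ := exists_le_specRad H μ
  exact (hc.trans_le (h q hq)).ne'

theorem specRad_ne_top {G : Type*} [Group G] (H : Subgroup G) (μ : PMF G) {q : ℝ}
    (hq : 1 ≤ q) : specRad H μ q ≠ ∞ := by
  refine ne_top_of_le_ne_top ?_ (specRad_le_markovPowNorm H μ hq one_ne_zero)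
  exact ENNReal.rpow_ne_top_of_nonneg (by positivity) (markovPowNorm_ne_top H μ q 1)

theorem log_toReal_markovPowNorm_rpow {G : Type*} [Group G] (H : Subgroup G) (μ : PMF G) {q : ℝ}
    (hq : 1 ≤ q) (n : ℕ) :
    Real.log (markovPowNorm H μ q n ^ (1 / n : ℝ)).toReal =
      Real.log (markovPowNorm H μ q n).toReal / n := by
  rw [← ENNReal.toReal_rpow, Real.log_rpow (ENNReal.toReal_pos (markovPowNorm_ne_zero H μ hq n)
    (markovPowNorm_ne_top H μ q n)), one_div_mul_eq_div]

theorem tendsto_log_markovPowNorm_div {G : Type*} [Group G] (H : Subgroup G) (μ : PMF G) {q : ℝ}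
    (hq : 1 ≤ q) :
    Tendsto (fun n : ℕ => Real.log (markovPowNorm H μ q n).toReal / n) atTop
      (𝓝 (Real.log (specRad H μ q).toReal)) := by
  have h1 := (ENNReal.tendsto_toReal (specRad_ne_top H μ hq)).comp (tendsto_markovPowNorm H μ hq)
  have h2 := h1.log (ENNReal.toReal_pos (specRad_ne_zero H μ hq) (specRad_ne_top H μ hq)).ne'
  exact h2.congr fun n => log_toReal_markovPowNorm_rpow H μ hq n

theorem log_specRad_le {G : Type*} [Group G] (H : Subgroup G) (μ : PMF G) {q : ℝ}
    (hq : 1 ≤ q) {n : ℕ} (hn : n ≠ 0) :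
    Real.log (specRad H μ q).toReal ≤ Real.log (markovPowNorm H μ q n).toReal / n := by
  rw [← log_toReal_markovPowNorm_rpow H μ hq]
  refine Real.log_le_log (ENNReal.toReal_pos (specRad_ne_zero H μ hq) (specRad_ne_top H μ hq)) ?_
  exact ENNReal.toReal_mono (ENNReal.rpow_ne_top_of_nonneg (by positivity)
    (markovPowNorm_ne_top H μ q n)) (specRad_le_markovPowNorm H μ hq hn)

theorem log_tsum_walkLaw_rpow_le {G : Type*} [Group G] (H : Subgroup G) (μ : PMF G) {q : ℝ}
    (hq : 1 ≤ q) (n : ℕ) :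
    Real.log (∑' x, walkLaw H μ n x ^ q).toReal ≤ q * Real.log (markovPowNorm H μ q n).toReal := by
  have hq0 : 0 < q := by linarith
  rw [← Real.log_rpow (ENNReal.toReal_pos (markovPowNorm_ne_zero H μ hq n)
    (markovPowNorm_ne_top H μ q n)), ENNReal.toReal_rpow]
  refine Real.log_le_log (ENNReal.toReal_pos (tsum_rpow_ne_zero _ hq0.le) (tsum_rpow_ne_top _ hq)) ?_
  exact ENNReal.toReal_mono (ENNReal.rpow_ne_top_of_nonneg hq0.le (markovPowNorm_ne_top H μ q n))
    (tsum_walkLaw_rpow_le H μ hq n)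

/-- The right-hand sum is the mean of Y^(q-1) under μ^{*n}, where Y(g) = ν_n(gH)(1+ℓ(g))^{2s₁}. -/
theorem PairRapidDecay.markovPowNorm_rpow_le {G : Type*} [Group G] {S : Finset G}
    {H : Subgroup G} {C s₁ : ℝ} (hRD : PairRapidDecay S H C s₁) (μ : PMF G) {q : ℝ} (hq : 1 < q)
    (hq2 : q ≤ 2) (n : ℕ) :
    markovPowNorm H μ q n ^ q ≤ ENNReal.ofReal C ^ (2 * (q - 1)) *
      ∑' g : G, convPow μ n g * lengthWeight S s₁ g ^ (2 * (q - 1)) *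
        walkLaw H μ n g ^ (q - 1) := by
  refine HomogeneousEntropy.markovPowNorm_rpow_le H μ hq.le n fun ξ hξ => ?_
  refine (hRD.tsum_act_rpow_le hq hq2 _ (convPow μ n).apply_ne_top ξ hξ).trans ?_
  simp only [walkLaw_apply]
  gcongr
  exact tsum_fiberSum_rpow_le H _ _ hq

theorem PairRapidDecay.log_markovPowNorm_le {G : Type*} [Group G] {S : Finset G}
    {H : Subgroup G} {C s₁ : ℝ} (hRD : PairRapidDecay S H C s₁) (μ : PMF G) {q : ℝ} (hq : 1 < q)
    (hq2 : q ≤ 2) (n : ℕ) {K : ℝ} (hK0 : 0 < K)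
    (hK : ∑' g : G, convPow μ n g * lengthWeight S s₁ g ^ (2 * (q - 1)) *
        walkLaw H μ n g ^ (q - 1) ≤ ENNReal.ofReal K) :
    q * Real.log (markovPowNorm H μ q n).toReal ≤ 2 * (q - 1) * Real.log C + Real.log K := by
  have hq0 : 0 < q := by linarith
  have hN0 := ENNReal.toReal_pos (markovPowNorm_ne_zero H μ hq.le n) (markovPowNorm_ne_top H μ q n)
  have hC := hRD.1
  rw [← Real.log_rpow hN0, ← Real.log_rpow hC, ← Real.log_mul (by positivity) hK0.ne',
    ENNReal.toReal_rpow]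
  refine Real.log_le_log ?_ (ENNReal.toReal_le_of_le_ofReal (by positivity) ?_)
  · rw [← ENNReal.toReal_rpow]
    positivity
  · refine (hRD.markovPowNorm_rpow_le μ hq hq2 n).trans ?_
    rw [ENNReal.ofReal_mul (by positivity), ENNReal.ofReal_rpow_of_pos hC]
    gcongr

/-! ### Logarithmic moments -/

/-- The mean of `log (1 + ℓ)` under the `n`-th convolution power. -/
def meanLogLength {G : Type*} [Group G] (S : Finset G) (μ : PMF G) (n : ℕ) : ℝ :=
  ∑' g, (convPow μ n g).toReal * Real.log (1 + (wordLength S g : ℝ))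

theorem hasFiniteMoment_iff {G : Type*} [Group G] (S : Finset G) (μ : PMF G) (β : ℝ) :
    HasFiniteMoment S μ β ↔ ∑' g, μ g * lengthWeight S β g < ∞ := Iff.rfl

theorem HasFiniteMoment.mono {G : Type*} [Group G] {S : Finset G} {μ : PMF G} {β γ : ℝ}
    (h : HasFiniteMoment S μ β) (hγ : γ ≤ β) : HasFiniteMoment S μ γ := by
  refine lt_of_le_of_lt (ENNReal.tsum_le_tsum fun g => ?_) h
  gcongr
  linarith [Nat.cast_nonneg (α := ℝ) (wordLength S g)]

theorem HasFiniteMoment.convPow {G : Type*} [Group G] {S : Finset G}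
    (hS : ∀ s ∈ S, s⁻¹ ∈ S) (hgen : Subgroup.closure (S : Set G) = ⊤) {μ : PMF G} {β : ℝ}
    (hβ : 0 ≤ β) (h : HasFiniteMoment S μ β) (n : ℕ) : HasFiniteMoment S (convPow μ n) β :=
  (tsum_convPow_mul_lengthWeight_le_pow hS hgen μ hβ n).trans_lt
    (ENNReal.pow_lt_top ((hasFiniteMoment_iff S μ β).1 h))

theorem HasFiniteMoment.summable {G : Type*} [Group G] {S : Finset G} {μ : PMF G} {β : ℝ}
    (h : HasFiniteMoment S μ β) :
    Summable fun g => (μ g).toReal * (1 + (wordLength S g : ℝ)) ^ β := by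
  refine (ENNReal.summable_toReal h.ne).congr fun g => ?_
  rw [ENNReal.toReal_mul, ENNReal.toReal_ofReal (by positivity)]

theorem HasFiniteMoment.toReal_tsum {G : Type*} [Group G] (S : Finset G) (μ : PMF G) (β : ℝ) :
    (∑' g, μ g * lengthWeight S β g).toReal =
      ∑' g, (μ g).toReal * (1 + (wordLength S g : ℝ)) ^ β := by
  rw [ENNReal.tsum_toReal_eq fun g => ENNReal.mul_ne_top (μ.apply_ne_top g)
    (lengthWeight_ne_top S β g)]
  refine tsum_congr fun g => ?_
  rw [ENNReal.toReal_mul, lengthWeight, ENNReal.toReal_ofReal (by positivity)]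

theorem HasFiniteMoment.summable_log {G : Type*} [Group G] {S : Finset G} {μ : PMF G} {β : ℝ}
    (hβ : 0 < β) (h : HasFiniteMoment S μ β) :
    Summable fun g => (μ g).toReal * Real.log (1 + (wordLength S g : ℝ)) := by
  have h1 : ∀ g : G, (1 : ℝ) ≤ 1 + (wordLength S g : ℝ) := fun g => by simp
  refine Summable.of_nonneg_of_le
    (fun g => mul_nonneg ENNReal.toReal_nonneg (Real.log_nonneg (h1 g))) (fun g => ?_)
    (h.summable.mul_right β⁻¹)
  rw [mul_assoc]
  gcongr
  rw [← div_eq_mul_inv]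
  exact Real.log_le_rpow_div (by positivity) hβ

/-- Jensen applied to (1+ℓ)^γ, followed by the linear moment bound, which is where γ ≤ 1 enters. -/
theorem meanLogLength_le {G : Type*} [Group G] {S : Finset G}
    (hS : ∀ s ∈ S, s⁻¹ ∈ S) (hgen : Subgroup.closure (S : Set G) = ⊤) {μ : PMF G} {γ : ℝ}
    (hγ : 0 < γ) (hγ1 : γ ≤ 1) (h : HasFiniteMoment S μ γ) (n : ℕ) :
    meanLogLength S μ n ≤
      γ⁻¹ * Real.log (1 + n * (∑' g, μ g * lengthWeight S γ g).toReal) := by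
  have hn := h.convPow hS hgen hγ.le n
  have hpos : ∀ g : G, 0 < (1 + (wordLength S g : ℝ)) ^ γ := fun g => by positivity
  have hlog : ∀ g : G, (convPow μ n g).toReal * Real.log ((1 + (wordLength S g : ℝ)) ^ γ) =
      γ * ((convPow μ n g).toReal * Real.log (1 + (wordLength S g : ℝ))) := fun g => by
    rw [Real.log_rpow (by positivity)]
    ring
  have hJ := tsum_mul_log_le_log_tsum (convPow μ n) (fun g _ => hpos g) hn.summable
    (((hn.summable_log hγ).mul_left γ).congr fun g => (hlog g).symm)
  rw [tsum_congr hlog, tsum_mul_left] at hJ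
  rw [meanLogLength, ← div_eq_inv_mul, le_div_iff₀ hγ, mul_comm]
  refine hJ.trans (Real.log_le_log (tsum_mul_pos _ (fun g _ => hpos g) hn.summable) ?_)
  rw [← HasFiniteMoment.toReal_tsum]
  have hfin : (n : ℝ≥0∞) * ∑' g, μ g * lengthWeight S γ g ≠ ∞ :=
    ENNReal.mul_ne_top (ENNReal.natCast_ne_top n) ((hasFiniteMoment_iff S μ γ).1 h).ne
  have := ENNReal.toReal_mono (ENNReal.add_ne_top.2 ⟨ENNReal.one_ne_top, hfin⟩)
    (tsum_convPow_mul_lengthWeight_le_mul hS hgen μ hγ.le hγ1 n)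
  rwa [ENNReal.toReal_add ENNReal.one_ne_top hfin, ENNReal.toReal_mul, ENNReal.toReal_one,
    ENNReal.toReal_natCast] at this

theorem tendsto_log_one_add_mul_div (M : ℝ) (hM : 0 ≤ M) :
    Tendsto (fun n : ℕ => Real.log (1 + n * M) / n) atTop (𝓝 0) := by
  have h1 : Tendsto (fun n : ℕ => Real.log n / n) atTop (𝓝 0) := by
    have := (Real.tendsto_pow_log_div_mul_add_atTop 1 0 1 one_ne_zero).comp
      (tendsto_natCast_atTop_atTop (R := ℝ))
    simpa [Function.comp_def] using this
  have h2 : Tendsto (fun n : ℕ => Real.log (1 + M) / n) atTop (𝓝 0) :=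
    tendsto_const_div_atTop_nhds_zero_nat _
  have h3 := h2.add h1
  rw [add_zero] at h3
  refine squeeze_zero' ?_ ?_ h3
  · filter_upwards with n
    exact div_nonneg (Real.log_nonneg (by nlinarith [mul_nonneg (Nat.cast_nonneg (α := ℝ) n) hM]))
      (Nat.cast_nonneg n)
  · filter_upwards [eventually_ge_atTop 1] with n hn
    have hn' : (1 : ℝ) ≤ n := by exact_mod_cast hn
    rw [← add_div, ← Real.log_mul (by positivity) (by positivity)]
    gcongr
    nlinarith

/-! ### Entropy bounds the spectral function from below -/

theorem convPow_le_walkLaw {G : Type*} [Group G] (H : Subgroup G) (μ : PMF G) (n : ℕ) (g : G) :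
    convPow μ n g ≤ walkLaw H μ n g := by
  rw [walkLaw_apply]
  exact le_fiberSum H _ g

theorem toReal_surprisal {t : ℝ≥0∞} (ht : t ≤ 1) : (surprisal t).toReal = -Real.log t.toReal := by
  refine ENNReal.toReal_ofReal (neg_nonneg.2 (Real.log_nonpos ENNReal.toReal_nonneg ?_))
  exact ENNReal.toReal_le_of_le_ofReal zero_le_one (by simpa using ht)

theorem tsum_convPow_mul_surprisal {G : Type*} [Group G] (H : Subgroup G) (μ : PMF G) (n : ℕ) :
    ∑' g : G, convPow μ n g * surprisal (walkLaw H μ n g) = shannonEntropy (walkLaw H μ n) := by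
  rw [shannonEntropy_eq_tsum_surprisal,
    ← tsum_fiberSum_mul H (convPow μ n) fun x => surprisal (walkLaw H μ n x)]
  simp only [← walkLaw_apply]

theorem hasSum_convPow_mul_log_walkLaw {G : Type*} [Group G] (H : Subgroup G) (μ : PMF G) (n : ℕ)
    (h : shannonEntropy (walkLaw H μ n) ≠ ∞) :
    HasSum (fun g : G => (convPow μ n g).toReal * Real.log (walkLaw H μ n g).toReal)
      (-(shannonEntropy (walkLaw H μ n)).toReal) := by
  rw [← tsum_convPow_mul_surprisal] at h ⊢
  have h1 := (ENNReal.hasSum_toReal h).neg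
  rw [ENNReal.tsum_toReal_eq (ENNReal.ne_top_of_tsum_ne_top h)]
  refine h1.congr_fun fun g => ?_
  rw [ENNReal.toReal_mul, toReal_surprisal ((walkLaw H μ n).coe_le_one _)]
  ring

/-- With n fixed and ε = q-1 = 1/(p-1) tending to 0, the bound of ‖P^n‖ by E[Y^ε] is expanded to
first order; the derivative E log Y carries the entropy. -/
theorem PairRapidDecay.eventually_le_spectral {G : Type*} [Group G] {S : Finset G}
    (hS : ∀ s ∈ S, s⁻¹ ∈ S) (hgen : Subgroup.closure (S : Set G) = ⊤)
    {H : Subgroup G} {C s₁ : ℝ} (hRD : PairRapidDecay S H C s₁) {μ : PMF G}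
    (hmom : HasFiniteMoment S μ (2 * s₁)) {n : ℕ} (hn : n ≠ 0)
    (hent : shannonEntropy (walkLaw H μ n) ≠ ∞) {δ : ℝ} (hδ : 0 < δ) :
    ∀ᶠ p : ℝ in atTop,
      ((shannonEntropy (walkLaw H μ n)).toReal - 2 * Real.log C - 2 * s₁ * meanLogLength S μ n) / n
        - δ ≤ -p * Real.log (specRad H μ (p / (p - 1))).toReal := by
  have hs := hRD.2.1
  have hn0 : (0 : ℝ) < n := by exact_mod_cast Nat.pos_of_ne_zero hn
  set m := convPow μ n with hm
  set ν := walkLaw H μ n with hν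
  set Y : G → ℝ := fun g => (ν g).toReal * (1 + (wordLength S g : ℝ)) ^ (2 * s₁) with hYdef
  have hmomn : HasFiniteMoment S m (2 * s₁) := hmom.convPow hS hgen (by positivity) n
  have hνpos : ∀ g, m g ≠ 0 → 0 < (ν g).toReal := fun g hg =>
    ENNReal.toReal_pos (ne_bot_of_le_ne_bot hg (convPow_le_walkLaw H μ n g)) (ν.apply_ne_top _)
  have hY0 : ∀ g, 0 ≤ Y g := fun g => by positivity
  have hY : ∀ g, m g ≠ 0 → 0 < Y g := fun g hg => by
    have := hνpos g hg
    positivity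
  -- Since ν ≤ 1, integrability of Y needs only the moment of order 2s₁.
  have h1 : Summable fun g => (m g).toReal * Y g := by
    refine Summable.of_nonneg_of_le (fun g => by positivity) (fun g => ?_) hmomn.summable
    gcongr
    refine mul_le_of_le_one_left (by positivity) ?_
    exact ENNReal.toReal_le_of_le_ofReal zero_le_one (by simpa using ν.coe_le_one _)
  have hlogY : HasSum (fun g => (m g).toReal * Real.log (Y g))
      (-(shannonEntropy ν).toReal + 2 * s₁ * meanLogLength S μ n) := by
    refine ((hasSum_convPow_mul_log_walkLaw H μ n hent).add
      ((hmomn.summable_log (by positivity)).hasSum.mul_left (2 * s₁))).congr_fun fun g => ?_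
    rcases eq_or_ne (m g) 0 with h | h
    · simp [← hm, h]
    · rw [hYdef, Real.log_mul (hνpos g h).ne' (by positivity), Real.log_rpow (by positivity)]
      ring
  have hΦ := tendsto_tsum_rpow_sub_one_div m hY h1 hlogY.summable
  rw [hlogY.tsum_eq] at hΦ
  have hε : Tendsto (fun p : ℝ => (p - 1)⁻¹) atTop (𝓝[>] 0) :=
    tendsto_inv_atTop_nhdsGT_zero.comp (tendsto_atTop_add_const_right _ (-1) tendsto_id)
  have hev := (hΦ.comp hε).eventually_lt_const
    (lt_add_of_pos_right _ (mul_pos hδ hn0))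
  filter_upwards [hev, eventually_ge_atTop 2] with p hp hp2
  simp only [Function.comp_apply] at hp
  set ε := (p - 1)⁻¹ with hεdef
  have hp1 : 0 < p - 1 := by linarith
  have hε0 : 0 < ε := inv_pos.2 hp1
  have hε1 : ε ≤ 1 := inv_le_one_of_one_le₀ (by linarith)
  set q := p / (p - 1) with hqdef
  have hqε : q - 1 = ε := by rw [hqdef, hεdef]; field_simp; ring
  have hpq : p * ε = q := by rw [hqdef, hεdef, div_eq_mul_inv]
  have hsumε : Summable fun g => (m g).toReal * Y g ^ ε := by
    refine Summable.of_nonneg_of_le (fun g => by positivity) (fun g => ?_)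
      ((summable_toReal_pmf m).add h1)
    rcases eq_or_ne (m g) 0 with h | h
    · simp [h]
    have h2 := rpow_sub_one_div_le (hY g h) hε0 hε1
    rw [div_le_iff₀ hε0] at h2
    have h3 : Y g ^ ε ≤ 1 + Y g := by nlinarith [hY g h]
    have := mul_le_mul_of_nonneg_left h3 (ENNReal.toReal_nonneg (a := m g))
    linarith
  have hK0 : 0 < ∑' g, (m g).toReal * Y g ^ ε :=
    tsum_mul_pos m (fun g hg => Real.rpow_pos_of_pos (hY g hg) _) hsumε
  have hbound := hRD.log_markovPowNorm_le μ (q := q) (by linarith) (by linarith) n hK0 (by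
    rw [ENNReal.ofReal_tsum_of_nonneg (fun g => by positivity) hsumε]
    refine ENNReal.tsum_le_tsum fun g => le_of_eq ?_
    rw [hqε, ENNReal.ofReal_mul ENNReal.toReal_nonneg, ENNReal.ofReal_toReal (m.apply_ne_top g),
      mul_assoc]
    congr 1
    rw [hYdef, Real.mul_rpow ENNReal.toReal_nonneg (by positivity), mul_comm,
      ENNReal.ofReal_mul (by positivity), ENNReal.toReal_rpow, ENNReal.ofReal_toReal
        (ENNReal.rpow_ne_top_of_nonneg hε0.le (ν.apply_ne_top _))]
    congr 1
    rw [lengthWeight, ENNReal.ofReal_rpow_of_pos (by positivity), ← Real.rpow_mul (by positivity),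
      ← Real.rpow_mul (by positivity)]
    congr 2
    ring)
  -- The bound log K ≤ K - 1 = εΦ supplies the factor ε that is divided out, with q/ε = p.
  have hlogK := Real.log_le_sub_one_of_pos hK0
  have hΦeq : ε * ∑' g, (m g).toReal * ((Y g ^ ε - 1) / ε) =
      ∑' g, (m g).toReal * Y g ^ ε - 1 := by
    rw [← tsum_mul_left]
    conv_rhs => rw [← tsum_toReal_pmf m]
    rw [← hsumε.tsum_sub (summable_toReal_pmf m)]
    refine tsum_congr fun g => ?_
    field_simp
  have hr := log_specRad_le H μ (q := q) (by linarith) hn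
  set N := Real.log (markovPowNorm H μ q n).toReal
  set Φ := ∑' g, (m g).toReal * ((Y g ^ ε - 1) / ε)
  have hN : p * N ≤ 2 * Real.log C + Φ := by
    rw [← mul_le_mul_iff_right₀ hε0]
    rw [hqε] at hbound
    calc ε * (p * N) = q * N := by rw [← hpq]; ring
      _ ≤ _ := by linarith
  have hr' : p * Real.log (specRad H μ q).toReal ≤ p * (N / n) := by gcongr
  have h5 : p * (N / n) ≤ (2 * Real.log C + Φ) / n := by
    rw [mul_div_assoc']
    gcongr
  have h6 : (2 * Real.log C + Φ) / n ≤ (2 * Real.log C + (-(shannonEntropy ν).toReal +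
      2 * s₁ * meanLogLength S μ n + δ * n)) / n := by gcongr
  have h7 : (2 * Real.log C + (-(shannonEntropy ν).toReal +
      2 * s₁ * meanLogLength S μ n + δ * n)) / n = -(((shannonEntropy ν).toReal -
      2 * Real.log C - 2 * s₁ * meanLogLength S μ n) / n - δ) := by
    field_simp
    ring
  linarith

/-! ### Comparing the two limits -/

/-- The limit is the supremum of ψ over p ≥ 2, finite thanks to M. By `h1` a is eventually almost
above it, by `h2` a n ≤ h + e n for n ≠ 0; then `h2` at one large n pushes ψ up to h. Neither
monotonicity of ψ nor subadditivity of n * a n is needed. -/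
theorem exists_common_limit {a e : ℕ → ℝ} {ψ : ℝ → ℝ} {M : ℝ} (hM : ∀ n, a n ≤ M)
    (he : Tendsto e atTop (𝓝 0))
    (h1 : ∀ p, 2 ≤ p → ∀ δ > 0, ∀ᶠ n in atTop, ψ p - δ ≤ a n)
    (h2 : ∀ n, n ≠ 0 → ∀ δ > 0, ∀ᶠ p in atTop, a n - e n - δ ≤ ψ p) :
    ∃ h : ℝ, Tendsto a atTop (𝓝 h) ∧ Tendsto ψ atTop (𝓝 h) := by
  have hbdd : BddAbove (ψ '' Set.Ici 2) := by
    refine ⟨M, ?_⟩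
    rintro _ ⟨p, hp, rfl⟩
    refine le_of_forall_pos_le_add fun δ hδ => ?_
    obtain ⟨n, hn⟩ := (h1 p hp δ hδ).exists
    linarith [hM n]
  set h := sSup (ψ '' Set.Ici 2) with hh
  have hle : ∀ p, 2 ≤ p → ψ p ≤ h := fun p hp => le_csSup hbdd ⟨p, hp, rfl⟩
  have hlow : ∀ δ > 0, ∀ᶠ n in atTop, h - δ ≤ a n := fun δ hδ => by
    obtain ⟨_, ⟨p, hp, rfl⟩, hpδ⟩ := exists_lt_of_lt_csSup (s := ψ '' Set.Ici 2)
      ⟨ψ 2, 2, le_refl (2 : ℝ), rfl⟩ (show h - δ / 2 < h by linarith)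
    filter_upwards [h1 p hp (δ / 2) (by linarith)] with n hn
    linarith
  have hup : ∀ n, n ≠ 0 → a n ≤ h + e n := fun n hn => by
    refine le_of_forall_pos_le_add fun δ hδ => ?_
    obtain ⟨p, hp, hp2⟩ := ((h2 n hn δ hδ).and (eventually_ge_atTop 2)).exists
    linarith [hle p hp2]
  have hesmall : ∀ δ > 0, ∀ᶠ n in atTop, e n ≤ δ := fun δ hδ =>
    (he.eventually_lt_const hδ).mono fun _ h => h.le
  refine ⟨h, Metric.tendsto_nhds.2 fun δ hδ => ?_, Metric.tendsto_nhds.2 fun δ hδ => ?_⟩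
  · filter_upwards [hlow (δ / 2) (by linarith), hesmall (δ / 2) (by linarith),
      eventually_ne_atTop 0] with n l1 l2 l3
    rw [Real.dist_eq, abs_lt]
    constructor <;> linarith [hup n l3]
  · obtain ⟨n, l1, l2, l3⟩ := ((hlow (δ / 4) (by linarith)).and
      ((hesmall (δ / 4) (by linarith)).and (eventually_ne_atTop 0))).exists
    filter_upwards [h2 n l3 (δ / 4) (by linarith), eventually_ge_atTop 2] with p k1 k2
    rw [Real.dist_eq, abs_lt]
    constructor <;> linarith [hle p k2]

/-! ### Finitely supported measures -/

theorem exists_wordLength_le_of_finite {G : Type*} [Group G] {S : Finset G}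
    (hS : ∀ s ∈ S, s⁻¹ ∈ S) (hgen : Subgroup.closure (S : Set G) = ⊤) (μ : PMF G)
    (hfin : μ.support.Finite) :
    ∃ L : ℕ, ∀ (n : ℕ) (g : G), convPow μ n g ≠ 0 → wordLength S g ≤ n * L := by
  refine ⟨hfin.toFinset.sup (wordLength S), fun n => ?_⟩
  induction n with
  | zero =>
    intro g hg
    have : g = 1 := by
      by_contra h
      exact hg (by simp [convPow, PMF.pure_apply, h])
    simp [this, wordLength_one]
  | succ n ih =>
    intro g hg
    rw [convPow_succ_apply, Ne, ENNReal.tsum_eq_zero, not_forall] at hg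
    obtain ⟨s, hs⟩ := hg
    have h1 : wordLength S s ≤ hfin.toFinset.sup (wordLength S) :=
      Finset.le_sup (by simpa using left_ne_zero_of_mul hs)
    have h2 := ih _ (right_ne_zero_of_mul hs)
    have h3 := wordLength_mul_le hS hgen s (s⁻¹ * g)
    rw [mul_inv_cancel_left] at h3
    rw [add_mul, one_mul]
    omega

/-- On the support of μ^{*n} the weight is at most a power of 1 + nL; it leaves the sum, and what
remains is exactly ∑ ν_n^q. Here q stays fixed. -/
theorem PairRapidDecay.log_markovPowNorm_le_of_finite {G : Type*} [Group G] {S : Finset G}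
    {H : Subgroup G} {C s₁ : ℝ} (hRD : PairRapidDecay S H C s₁) {μ : PMF G} {q : ℝ} (hq : 1 < q)
    (hq2 : q ≤ 2) {n L : ℕ} (hL : ∀ g : G, convPow μ n g ≠ 0 → wordLength S g ≤ n * L) :
    q * Real.log (markovPowNorm H μ q n).toReal ≤ 2 * (q - 1) * Real.log C +
      (2 * (q - 1) * s₁ * Real.log (1 + n * L) + Real.log (∑' x, walkLaw H μ n x ^ q).toReal) := by
  have hs := hRD.2.1
  have hSpos := ENNReal.toReal_pos (tsum_rpow_ne_zero (walkLaw H μ n) (α := q) (by linarith))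
    (tsum_rpow_ne_top _ hq.le)
  have hb : (0 : ℝ) < 1 + n * L := by positivity
  rw [← Real.log_rpow hb, ← Real.log_mul (by positivity) hSpos.ne']
  refine hRD.log_markovPowNorm_le μ hq hq2 n (by positivity) ?_
  rw [ENNReal.ofReal_mul (by positivity), ENNReal.ofReal_toReal (tsum_rpow_ne_top _ hq.le)]
  calc ∑' g : G, convPow μ n g * lengthWeight S s₁ g ^ (2 * (q - 1)) * walkLaw H μ n g ^ (q - 1)
      ≤ ∑' g : G, ENNReal.ofReal ((1 + n * L) ^ (2 * (q - 1) * s₁)) *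
          (convPow μ n g * walkLaw H μ n g ^ (q - 1)) := by
        refine ENNReal.tsum_le_tsum fun g => ?_
        rcases eq_or_ne (convPow μ n g) 0 with h | h
        · simp [h]
        have h1 : (wordLength S g : ℝ) ≤ n * L := by exact_mod_cast hL g h
        have h2 : lengthWeight S s₁ g ^ (2 * (q - 1)) ≤
            ENNReal.ofReal ((1 + n * L) ^ (2 * (q - 1) * s₁)) := by
          rw [lengthWeight, ENNReal.ofReal_rpow_of_pos (by positivity),
            ← Real.rpow_mul (by positivity), mul_comm s₁]
          have : 0 ≤ q - 1 := by linarith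
          gcongr
        calc _ ≤ convPow μ n g * ENNReal.ofReal ((1 + n * L) ^ (2 * (q - 1) * s₁)) *
              walkLaw H μ n g ^ (q - 1) := by gcongr
          _ = _ := by ring
    _ = ENNReal.ofReal ((1 + n * L) ^ (2 * (q - 1) * s₁)) * ∑' x, walkLaw H μ n x ^ q := by
        rw [ENNReal.tsum_mul_left, ← tsum_fiberSum_mul H (convPow μ n) fun x =>
          walkLaw H μ n x ^ (q - 1)]
        congr 1
        refine tsum_congr fun x => ?_
        rw [← walkLaw_apply]
        conv_lhs => rw [← ENNReal.rpow_one (walkLaw H μ n x), ← ENNReal.rpow_mul, one_mul]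
        rw [← ENNReal.rpow_add_of_nonneg _ _ zero_le_one (by linarith)]
        congr 1
        ring

/-! ### Passage to extended reals -/

theorem shannonSeq_eq_coe {G : Type*} [Group G] (H : Subgroup G) (μ : PMF G)
    (n : ℕ) (h : shannonEntropy (walkLaw H μ n) ≠ ∞) :
    shannonSeq H μ n = (((shannonEntropy (walkLaw H μ n)).toReal / n : ℝ) : EReal) := by
  rw [shannonSeq, EReal.coe_div, EReal.coe_ennreal_toReal h]
  rfl

theorem renyiSeq_eq_coe {G : Type*} [Group G] (H : Subgroup G) (μ : PMF G) {α : ℝ} (hα : 1 ≤ α)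
    (n : ℕ) :
    renyiSeq H μ α n =
      ((1 / (1 - α) * Real.log (∑' x, walkLaw H μ n x ^ α).toReal / n : ℝ) : EReal) := by
  rw [renyiSeq, renyiEntropy_eq_coe _ hα, EReal.coe_div]
  rfl

theorem log_specRad_eq_coe {G : Type*} [Group G] (H : Subgroup G) (μ : PMF G) {q : ℝ}
    (hq : 1 ≤ q) :
    ENNReal.log (specRad H μ q) = ((Real.log (specRad H μ q).toReal : ℝ) : EReal) :=
  ENNReal.log_pos_real (specRad_ne_zero H μ hq) (specRad_ne_top H μ hq)

theorem one_le_div_sub_one {p : ℝ} (hp : 1 < p) : 1 ≤ p / (p - 1) := by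
  rw [one_le_div (by linarith)]
  linarith

theorem spectralFun_eq_coe {G : Type*} [Group G] (H : Subgroup G) (μ : PMF G) {p : ℝ}
    (hp : 1 < p) :
    spectralFun H μ p = ((-p * Real.log (specRad H μ (p / (p - 1))).toReal : ℝ) : EReal) := by
  rw [spectralFun, log_specRad_eq_coe H μ (one_le_div_sub_one hp), EReal.coe_mul]

/-- The negative factor 1/(1-α) turns the upper bound on ∑ ν_n^α into a lower bound on Rényi
entropy. -/
theorem mul_log_markovPowNorm_le_renyi {G : Type*} [Group G] (H : Subgroup G) (μ : PMF G) {α : ℝ}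
    (hα : 1 < α) (n : ℕ) :
    α / (1 - α) * (Real.log (markovPowNorm H μ α n).toReal / n) ≤
      1 / (1 - α) * Real.log (∑' x, walkLaw H μ n x ^ α).toReal / n := by
  have h := log_tsum_walkLaw_rpow_le H μ hα.le n
  have h1 : 1 / (1 - α) ≤ 0 := one_div_nonpos.2 (by linarith)
  calc α / (1 - α) * (Real.log (markovPowNorm H μ α n).toReal / n)
      = 1 / (1 - α) * (α * Real.log (markovPowNorm H μ α n).toReal) / n := by ring
    _ ≤ _ := by
      gcongr ?_ / _
      exact mul_le_mul_of_nonpos_left h h1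

/-- The Rényi rate is squeezed between two multiples of log ‖P^n‖/n with equal coefficient, up to an
error of order log n / n. -/
theorem PairRapidDecay.tendsto_renyi_of_finite {G : Type*} [Group G] {S : Finset G}
    (hS : ∀ s ∈ S, s⁻¹ ∈ S) (hgen : Subgroup.closure (S : Set G) = ⊤)
    {H : Subgroup G} {C s₁ : ℝ} (hRD : PairRapidDecay S H C s₁) {μ : PMF G}
    (hfin : μ.support.Finite) {α : ℝ} (hα : 1 < α) (hα2 : α ≤ 2) :
    Tendsto (fun n : ℕ => 1 / (1 - α) * Real.log (∑' x, walkLaw H μ n x ^ α).toReal / n) atTop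
      (𝓝 (α / (1 - α) * Real.log (specRad H μ α).toReal)) := by
  obtain ⟨L, hL⟩ := exists_wordLength_le_of_finite hS hgen μ hfin
  have hlow := (tendsto_log_markovPowNorm_div H μ hα.le).const_mul (α / (1 - α))
  have herr : Tendsto (fun n : ℕ => 2 * Real.log C / n + 2 * s₁ * (Real.log (1 + n * L) / n))
      atTop (𝓝 (0 + 2 * s₁ * 0)) :=
    (tendsto_const_div_atTop_nhds_zero_nat _).add
      ((tendsto_log_one_add_mul_div L (Nat.cast_nonneg L)).const_mul _)
  have hup := hlow.add herr
  rw [mul_zero, add_zero, add_zero] at hup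
  refine tendsto_of_tendsto_of_tendsto_of_le_of_le hlow hup
    (fun n => mul_log_markovPowNorm_le_renyi H μ hα n) fun n => ?_
  have h := hRD.log_markovPowNorm_le_of_finite hα hα2 (hL n)
  set N := Real.log (markovPowNorm H μ α n).toReal
  set R := Real.log (∑' x, walkLaw H μ n x ^ α).toReal
  have h1 : 1 / (1 - α) * R ≤ α / (1 - α) * N + 2 * Real.log C +
      2 * s₁ * Real.log (1 + n * L) := by
    have hne : 1 - α ≠ 0 := by linarith
    rw [one_div_mul_eq_div, div_le_iff_of_neg (by linarith)]
    calc (α / (1 - α) * N + 2 * Real.log C + 2 * s₁ * Real.log (1 + n * L)) * (1 - α)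
        = α * N + (2 * Real.log C + 2 * s₁ * Real.log (1 + n * L)) * (1 - α) := by
          field_simp
          ring
      _ ≤ R := by linarith
  calc 1 / (1 - α) * R / n
      ≤ (α / (1 - α) * N + 2 * Real.log C + 2 * s₁ * Real.log (1 + n * L)) / n := by gcongr
    _ = _ := by ring

/-- The real form of the identity between asymptotic entropy and the spectral limit. -/
theorem PairRapidDecay.exists_entropy {G : Type*} [Group G] {S : Finset G}
    (hS : ∀ s ∈ S, s⁻¹ ∈ S) (hgen : Subgroup.closure (S : Set G) = ⊤)
    {H : Subgroup G} {C s₁ : ℝ} (hRD : PairRapidDecay S H C s₁) {μ : PMF G}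
    (hent : shannonEntropy μ < ∞) (hmom : HasFiniteMoment S μ (2 * s₁)) :
    ∃ h : ℝ, Tendsto (fun n : ℕ => (shannonEntropy (walkLaw H μ n)).toReal / n) atTop (𝓝 h) ∧
      Tendsto (fun p : ℝ => -p * Real.log (specRad H μ (p / (p - 1))).toReal) atTop (𝓝 h) := by
  have hs := hRD.2.1
  have hentn : ∀ n, shannonEntropy (walkLaw H μ n) ≠ ∞ := fun n =>
    ne_top_of_le_ne_top (ENNReal.mul_ne_top (ENNReal.natCast_ne_top n) hent.ne)
      (shannonEntropy_walkLaw_le H μ n)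
  -- An exponent with finite moment that is also at most 1, as the linear moment bound requires.
  set γ := min (2 * s₁) 1 with hγ
  have hγ0 : 0 < γ := lt_min (by positivity) one_pos
  have hmγ : HasFiniteMoment S μ γ := hmom.mono (min_le_left _ _)
  set M := (∑' g, μ g * lengthWeight S γ g).toReal with hM
  have herr : Tendsto (fun n : ℕ => 2 * Real.log C / n + 2 * s₁ * γ⁻¹ * (Real.log (1 + n * M) / n))
      atTop (𝓝 (0 + 2 * s₁ * γ⁻¹ * 0)) :=
    (tendsto_const_div_atTop_nhds_zero_nat _).add
      ((tendsto_log_one_add_mul_div M ENNReal.toReal_nonneg).const_mul _)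
  rw [mul_zero, add_zero] at herr
  refine exists_common_limit
    (a := fun n : ℕ => (shannonEntropy (walkLaw H μ n)).toReal / n)
    (ψ := fun p : ℝ => -p * Real.log (specRad H μ (p / (p - 1))).toReal)
    (M := (shannonEntropy μ).toReal) (fun n => ?_) herr (fun p hp δ hδ => ?_)
    (fun n hn δ hδ => ?_)
  · refine div_le_of_le_mul₀ (Nat.cast_nonneg n) ENNReal.toReal_nonneg ?_
    have := ENNReal.toReal_mono (ENNReal.mul_ne_top (ENNReal.natCast_ne_top n) hent.ne)
      (shannonEntropy_walkLaw_le H μ n)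
    rwa [ENNReal.toReal_mul, ENNReal.toReal_natCast, mul_comm] at this
  -- With p fixed, q/(1-q) = -p; the norm bounds Rényi entropy of order q from below, and Shannon
  -- entropy dominates it.
  · set q := p / (p - 1) with hq
    have hp1 : 0 < p - 1 := by linarith
    have hq1 : 1 < q := by rw [hq, lt_div_iff₀ hp1]; linarith
    have hpq : q / (1 - q) = -p := by
      have : 1 - q = -(p - 1)⁻¹ := by rw [hq]; field_simp; ring
      rw [this, hq]
      field_simp
    have hlim := (tendsto_log_markovPowNorm_div H μ hq1.le).const_mul (-p)
    filter_upwards [hlim.eventually_const_lt (sub_lt_self _ hδ)] with n hn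
    refine hn.le.trans ?_
    rw [← hpq]
    refine (mul_log_markovPowNorm_le_renyi H μ hq1 n).trans ?_
    gcongr
    exact renyi_le_shannon _ (hentn n) hq1
  · filter_upwards [hRD.eventually_le_spectral hS hgen hmom hn (hentn n) hδ] with p hp
    refine le_trans ?_ hp
    have hL := meanLogLength_le hS hgen hγ0 (min_le_right _ _) hmγ n
    have hn0 : (0 : ℝ) < n := by exact_mod_cast Nat.pos_of_ne_zero hn
    have : 2 * s₁ * meanLogLength S μ n / n ≤ 2 * s₁ * (γ⁻¹ * Real.log (1 + n * M)) / n := by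
      gcongr
    have e1 : ((shannonEntropy (walkLaw H μ n)).toReal - 2 * Real.log C -
        2 * s₁ * meanLogLength S μ n) / n = (shannonEntropy (walkLaw H μ n)).toReal / n -
        2 * Real.log C / n - 2 * s₁ * meanLogLength S μ n / n := by ring
    have e2 : 2 * s₁ * (γ⁻¹ * Real.log (1 + n * M)) / n =
      2 * s₁ * γ⁻¹ * (Real.log (1 + n * M) / n) := by ring
    rw [e1]
    linarith

theorem tendsto_div_sub_one_nhdsGT_one :
    Tendsto (fun α : ℝ => α / (α - 1)) (𝓝[>] 1) atTop := by
  have h1 : Tendsto (fun α : ℝ => α - 1) (𝓝[>] 1) (𝓝[>] 0) := by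
    refine tendsto_nhdsWithin_iff.2 ⟨?_, ?_⟩
    · have : Tendsto (fun α : ℝ => α - 1) (𝓝 1) (𝓝 (1 - 1)) := tendsto_id.sub_const 1
      rw [sub_self] at this
      exact this.mono_left nhdsWithin_le_nhds
    · filter_upwards [self_mem_nhdsWithin] with α hα
      exact sub_pos.2 (Set.mem_Ioi.1 hα)
  have h2 : Tendsto (fun α : ℝ => α) (𝓝[>] 1) (𝓝 1) := tendsto_id.mono_left nhdsWithin_le_nhds
  exact h2.pos_mul_atTop one_pos (tendsto_inv_nhdsGT_zero.comp h1)

/-- Taking conjugate exponents is an involution, so p = α/(α-1) turns the limit p → ∞ into α ↓ 1. -/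
theorem div_sub_one_div_sub_one {α : ℝ} (hα : 1 < α) :
    α / (α - 1) / (α / (α - 1) - 1) = α := by
  have : α - 1 ≠ 0 := by linarith
  have h : α / (α - 1) - 1 = (α - 1)⁻¹ := by field_simp; ring
  rw [h]
  field_simp

end HomogeneousEntropy

end

/-! ### Assembly of the main theorem -/

open HomogeneousEntropy in
theorem theoremA {G : Type*} [Group G] (S : Finset G)
    (hSsymm : ∀ s ∈ S, s⁻¹ ∈ S) (hSgen : Subgroup.closure (S : Set G) = ⊤)
    (H : Subgroup G) (C s₁ : ℝ) (hRD : PairRapidDecay S H C s₁)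
    (μ : PMF G) (hent : shannonEntropy μ < ∞)
    (β : ℝ) (hβ : 2 * s₁ ≤ β) (hmom : HasFiniteMoment S μ β) :
    -- the limit defining `c(G,H;μ)` exists
    Tendsto (spectralFun H μ) atTop (𝓝 (spectralEntropy H μ)) ∧
    lowerEntropy H μ = spectralEntropy H μ ∧
    upperEntropy H μ = spectralEntropy H μ ∧
    -- the asymptotic Shannon entropy `h` exists (as a finite limit)
    ∃ h : ℝ,
      (h : EReal) = spectralEntropy H μ ∧
      Tendsto (shannonSeq H μ) atTop (𝓝 (h : EReal)) ∧
      Tendsto (lowerRenyiRate H μ) (𝓝[>] 1) (𝓝 (h : EReal)) ∧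
      Tendsto (upperRenyiRate H μ) (𝓝[>] 1) (𝓝 (h : EReal)) ∧
      (μ.support.Finite →
        ∃ hα : ℝ → ℝ,
          (∀ α : ℝ, 1 < α → α ≤ 2 →
            Tendsto (renyiSeq H μ α) atTop (𝓝 (hα α : EReal)) ∧
            (hα α : EReal) = ((α / (1 - α) : ℝ) : EReal) * ENNReal.log (specRad H μ α)) ∧
          Tendsto hα (𝓝[>] 1) (𝓝 h)) := by
  obtain ⟨h, hH, hψ⟩ := hRD.exists_entropy hSsymm hSgen hent (hmom.mono hβ)
  have hentn : ∀ n, shannonEntropy (walkLaw H μ n) ≠ ∞ := fun n =>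
    ne_top_of_le_ne_top (ENNReal.mul_ne_top (ENNReal.natCast_ne_top n) hent.ne)
      (shannonEntropy_walkLaw_le H μ n)
  have hspec : Tendsto (spectralFun H μ) atTop (𝓝 (h : EReal)) := by
    refine ((continuous_coe_real_ereal.tendsto h).comp hψ).congr' ?_
    filter_upwards [eventually_gt_atTop 1] with p hp
    exact (spectralFun_eq_coe H μ hp).symm
  have hc : spectralEntropy H μ = h := hspec.limUnder_eq
  have hshan : Tendsto (shannonSeq H μ) atTop (𝓝 (h : EReal)) :=
    ((continuous_coe_real_ereal.tendsto h).comp hH).congr fun n =>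
      (shannonSeq_eq_coe H μ n (hentn n)).symm
  have hhα : Tendsto (fun α : ℝ => α / (1 - α) * Real.log (specRad H μ α).toReal) (𝓝[>] 1)
      (𝓝 h) := by
    refine (hψ.comp tendsto_div_sub_one_nhdsGT_one).congr' ?_
    filter_upwards [self_mem_nhdsWithin] with α hα
    simp only [Function.comp_apply]
    rw [div_sub_one_div_sub_one hα, ← neg_sub α 1, div_neg]
  have hhα' := (continuous_coe_real_ereal.tendsto h).comp hhα
  -- Both Rényi rates are trapped between α/(1-α) log r_α, which tends to h, and h itself; this
  -- holds without finite support.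
  have hlow : ∀ᶠ α in 𝓝[>] (1 : ℝ),
      ((α / (1 - α) * Real.log (specRad H μ α).toReal : ℝ) : EReal) ≤ lowerRenyiRate H μ α := by
    filter_upwards [self_mem_nhdsWithin] with α hα
    have hα1 : 1 < α := hα
    have hlim := (continuous_coe_real_ereal.tendsto _).comp
      ((tendsto_log_markovPowNorm_div H μ hα1.le).const_mul (α / (1 - α)))
    rw [← hlim.liminf_eq]
    refine liminf_le_liminf (Eventually.of_forall fun n => ?_)
    rw [renyiSeq_eq_coe H μ hα1.le]
    exact EReal.coe_le_coe_iff.2 (mul_log_markovPowNorm_le_renyi H μ hα1 n)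
  have hmid : ∀ α, lowerRenyiRate H μ α ≤ upperRenyiRate H μ α := fun α => liminf_le_limsup
  have hupp : ∀ᶠ α in 𝓝[>] (1 : ℝ), upperRenyiRate H μ α ≤ h := by
    filter_upwards [self_mem_nhdsWithin] with α hα
    have hα1 : 1 < α := hα
    rw [← hshan.limsup_eq]
    refine limsup_le_limsup (Eventually.of_forall fun n => ?_)
    rw [renyiSeq_eq_coe H μ hα1.le, shannonSeq_eq_coe H μ n (hentn n)]
    refine EReal.coe_le_coe_iff.2 ?_
    gcongr
    exact renyi_le_shannon _ (hentn n) hα1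
  refine ⟨hc ▸ hspec, hc ▸ hshan.liminf_eq, hc ▸ hshan.limsup_eq, h, hc.symm, hshan, ?_, ?_, ?_⟩
  · refine tendsto_of_tendsto_of_tendsto_of_le_of_le' hhα' tendsto_const_nhds hlow ?_
    filter_upwards [hupp] with α hα
    exact (hmid α).trans hα
  · refine tendsto_of_tendsto_of_tendsto_of_le_of_le' hhα' tendsto_const_nhds ?_ hupp
    filter_upwards [hlow] with α hα
    exact hα.trans (hmid α)
  · intro hfin
    refine ⟨fun α => α / (1 - α) * Real.log (specRad H μ α).toReal, fun α hα hα2 => ⟨?_, ?_⟩, hhα⟩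
    · exact ((continuous_coe_real_ereal.tendsto _).comp
        (hRD.tendsto_renyi_of_finite hSsymm hSgen hfin hα hα2)).congr fun n =>
          (renyiSeq_eq_coe H μ hα.le n).symm
    · rw [log_specRad_eq_coe H μ hα.le, EReal.coe_mul]
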